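/- There are a program for a unit-cost random access machine (arithmetic operations: addition, truncated subtraction and comparison of natural numbers) and a polynomial $P$ such that the following holds. Let $G$ be a finite simple undirected graph with $n$ vertices and $m$ edges, given by a list of its edges, and let $r \ge 0$ be an integer. On input $(G, r)$ the program halts within $P(n + m + r)$ steps. If $G$ is connected, it outputs $r$ (not necessarily distinct) spanning trees $T_1, \ldots, T_r$ of $G$, in the form of the characteristic vectors of their edge sets with respect to the given list of edges, such that $$d_{\rm sum}(E(T_1), \ldots, E(T_r)) = \sum_{1 \le i < j \le r} \bigl(|E(T_i) \setminus E(T_j)| + |E(T_j) \setminus E(T_i)|\bigr)$$ is maximum among all $r$-tuples of (not necessarily distinct) spanning trees of $G$. -/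

import Mathlib

/-! ### A random access machine with a step count

Programs are structured programs of a random access machine over the natural numbers. The memory
consists of variables and of (unbounded) arrays, both named by numerals that are fixed in the
program text; an array may be addressed by a computed index. The only arithmetic operations are
addition, truncated subtraction and comparison. Every operation costs one step; as there is no
multiplication, this is the usual unit-cost machine, polynomially equivalent to Turing machines. -/

namespace RAM

/-- Memory: `var x` is the value of variable `x`, and `arr a i` is cell `i` of array `a`. -/
structure State where
  var : ℕ → ℕ
  arr : ℕ → ℕ → ℕ

/-- Expressions; `read a i` is the content of cell `i` of array `a`. -/
inductive Expr where
  | const (k : ℕ)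
  | var (x : ℕ)
  | read (a : ℕ) (i : Expr)
  | add (e₁ e₂ : Expr)
  | sub (e₁ e₂ : Expr)
  | eq (e₁ e₂ : Expr)
  | lt (e₁ e₂ : Expr)

/-- The value of an expression; comparisons have value `1` or `0`. -/
def Expr.eval (s : State) : Expr → ℕ
  | .const k => k
  | .var x => s.var x
  | .read a i => s.arr a (i.eval s)
  | .add e₁ e₂ => e₁.eval s + e₂.eval s
  | .sub e₁ e₂ => e₁.eval s - e₂.eval s
  | .eq e₁ e₂ => if e₁.eval s = e₂.eval s then 1 else 0
  | .lt e₁ e₂ => if e₁.eval s < e₂.eval s then 1 else 0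

/-- The number of steps for evaluating an expression: one for each of its nodes. -/
def Expr.cost : Expr → ℕ
  | .const _ => 1
  | .var _ => 1
  | .read _ i => i.cost + 1
  | .add e₁ e₂ => e₁.cost + e₂.cost + 1
  | .sub e₁ e₂ => e₁.cost + e₂.cost + 1
  | .eq e₁ e₂ => e₁.cost + e₂.cost + 1
  | .lt e₁ e₂ => e₁.cost + e₂.cost + 1

/-- Programs. `branch e c d` runs `c` if the value of `e` is nonzero and `d` otherwise;
`loop e c` runs `c` repeatedly as long as the value of `e` is nonzero. -/
inductive Program where
  | skip
  | assign (x : ℕ) (e : Expr)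
  | store (a : ℕ) (i e : Expr)
  | seq (c d : Program)
  | branch (e : Expr) (c d : Program)
  | loop (e : Expr) (c : Program)

/-- The state after assigning `v` to variable `x`. -/
def State.setVar (s : State) (x v : ℕ) : State :=
  { s with var := Function.update s.var x v }

/-- The state after writing `v` into cell `i` of array `a`. -/
def State.setArr (s : State) (a i v : ℕ) : State :=
  { s with arr := Function.update s.arr a (Function.update (s.arr a) i v) }

/-- `Exec c s t s'`: started in state `s`, the program `c` halts after exactly `t` steps, in
state `s'`. -/
inductive Exec : Program → State → ℕ → State → Prop where
  | skip (s : State) : Exec .skip s 1 s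
  | assign (s : State) (x : ℕ) (e : Expr) :
      Exec (.assign x e) s (e.cost + 1) (s.setVar x (e.eval s))
  | store (s : State) (a : ℕ) (i e : Expr) :
      Exec (.store a i e) s (i.cost + e.cost + 1) (s.setArr a (i.eval s) (e.eval s))
  | seq {c d : Program} {s s₁ s₂ : State} {t₁ t₂ : ℕ} :
      Exec c s t₁ s₁ → Exec d s₁ t₂ s₂ → Exec (.seq c d) s (t₁ + t₂) s₂
  | branch_true {e : Expr} {c d : Program} {s s₁ : State} {t : ℕ} :
      e.eval s ≠ 0 → Exec c s t s₁ → Exec (.branch e c d) s (e.cost + 1 + t) s₁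
  | branch_false {e : Expr} {c d : Program} {s s₁ : State} {t : ℕ} :
      e.eval s = 0 → Exec d s t s₁ → Exec (.branch e c d) s (e.cost + 1 + t) s₁
  | loop_done {e : Expr} {c : Program} {s : State} :
      e.eval s = 0 → Exec (.loop e c) s (e.cost + 1) s
  | loop_step {e : Expr} {c : Program} {s s₁ s₂ : State} {t₁ t₂ : ℕ} :
      e.eval s ≠ 0 → Exec c s t₁ s₁ → Exec (.loop e c) s₁ t₂ s₂ →
        Exec (.loop e c) s (e.cost + 1 + t₁ + t₂) s₂

/-- The machine is deterministic: step count and final state are determined by program and initial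
state. -/
theorem Exec.deterministic {c : Program} {s s₁ s₂ : State} {t₁ t₂ : ℕ}
    (h₁ : Exec c s t₁ s₁) (h₂ : Exec c s t₂ s₂) : t₁ = t₂ ∧ s₁ = s₂ := by
  induction h₁ generalizing t₂ s₂ with
  | skip s => cases h₂; exact ⟨rfl, rfl⟩
  | assign s x e => cases h₂; exact ⟨rfl, rfl⟩
  | store s a i e => cases h₂; exact ⟨rfl, rfl⟩
  | seq _ _ ih₁ ih₂ =>
    cases h₂ with
    | seq g₁ g₂ =>
      obtain ⟨rfl, rfl⟩ := ih₁ g₁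
      obtain ⟨rfl, rfl⟩ := ih₂ g₂
      exact ⟨rfl, rfl⟩
  | branch_true he _ ih =>
    cases h₂ with
    | branch_true _ g => obtain ⟨rfl, rfl⟩ := ih g; exact ⟨rfl, rfl⟩
    | branch_false ge _ => exact absurd ge he
  | branch_false he _ ih =>
    cases h₂ with
    | branch_true ge _ => exact absurd he ge
    | branch_false _ g => obtain ⟨rfl, rfl⟩ := ih g; exact ⟨rfl, rfl⟩
  | loop_done he =>
    cases h₂ with
    | loop_done _ => exact ⟨rfl, rfl⟩
    | loop_step ge _ _ => exact absurd he ge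
  | loop_step he _ _ ih₁ ih₂ =>
    cases h₂ with
    | loop_done ge => exact absurd ge he
    | loop_step _ g₁ g₂ =>
      obtain ⟨rfl, rfl⟩ := ih₁ g₁
      obtain ⟨rfl, rfl⟩ := ih₂ g₂
      exact ⟨rfl, rfl⟩

/-- The initial state: array `0` holds the input and variable `0` its length; the rest is zero. -/
def State.init (input : List ℕ) : State where
  var x := if x = 0 then input.length else 0
  arr a i := if a = 0 then input.getD i 0 else 0

/-- The output in a final state: the first `var 1` cells of array `1`. -/
def State.output (s : State) : List ℕ :=
  (List.range (s.var 1)).map (s.arr 1)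

/-- Run on `input`, the program `c` halts within `bound` steps, with output `out`. -/
def Program.OutputsWithin (c : Program) (input out : List ℕ) (bound : ℕ) : Prop :=
  ∃ (t : ℕ) (s : State), Exec c (State.init input) t s ∧ t ≤ bound ∧ s.output = out

end RAM

/-! ### Diverse spanning trees -/

/-- The sum of the pairwise Hamming distances of finite sets `U 0, …, U (r - 1)`. -/
noncomputable def dSum {α : Type*} {r : ℕ} (U : Fin r → Set α) : ℕ :=
  ∑ i : Fin r, ∑ j : Fin r,
    if i < j then (U i \ U j).ncard + (U j \ U i).ncard else 0

/-- `T` is (as a graph on all the vertices of `G`) a spanning tree of `G`. -/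
def IsSpanningTree {V : Type*} (G T : SimpleGraph V) : Prop :=
  T ≤ G ∧ T.IsTree

/-- `T` is a family of `r` (not necessarily distinct) spanning trees of `G` that maximizes the sum
of the pairwise Hamming distances of the edge sets among all such families. -/
def IsMostDiverse {V : Type*} {r : ℕ} (G : SimpleGraph V) (T : Fin r → SimpleGraph V) : Prop :=
  (∀ i, IsSpanningTree G (T i)) ∧
    ∀ T' : Fin r → SimpleGraph V, (∀ i, IsSpanningTree G (T' i)) →
      dSum (fun i => (T' i).edgeSet) ≤ dSum (fun i => (T i).edgeSet)

/-- `es` lists every edge of `G` exactly once, each in one of its two orientations. -/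
def IsEdgeList {n : ℕ} (G : SimpleGraph (Fin n)) (es : List (Fin n × Fin n)) : Prop :=
  (es.map fun p => s(p.1, p.2)).Nodup ∧
    ∀ e : Sym2 (Fin n), e ∈ (es.map fun p => s(p.1, p.2)) ↔ e ∈ G.edgeSet

/-- The input `n, m, r, u₀, v₀, …, u_{m-1}, v_{m-1}` for the graph on the vertices `0, …, n - 1`
with the `m` edges `u_k v_k`, and the integer `r`. -/
def encodeInstance (n r : ℕ) (es : List (Fin n × Fin n)) : List ℕ :=
  n :: es.length :: r :: es.flatMap fun p => [(p.1 : ℕ), (p.2 : ℕ)]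

open Classical in
/-- The output for the trees `T 0, …, T (r - 1)`: the concatenation of the characteristic vectors
of their edge sets, with respect to the order of the edges in the input. -/
noncomputable def encodeTrees {n r : ℕ} (es : List (Fin n × Fin n))
    (T : Fin r → SimpleGraph (Fin n)) : List ℕ :=
  (List.finRange r).flatMap fun i => es.map fun p => if (T i).Adj p.1 p.2 then 1 else 0

/-!
# Most diverse spanning trees in polynomial time

If the edge `e` lies in `c e` of the `r` trees, then it contributes `c e * (r - c e)` to the sum of
the pairwise distances. As the sum of all `c e` is the same for all families of spanning trees, the
task is to minimize the sum of the squares `(c e) ^ 2` (`Enumerates.dSum_add_overlap`).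

Spanning trees are treated as bases of a family of vectors, the rows of the incidence matrix.
There is an arc from `e` to `f` if in one of the trees `f` can be exchanged for `e`. A path of arcs
from `a` to some `f` with `c f ≥ c a + 2` calls for exchanges along the path, which raise `c a` and
lower `c f` by one and change no other multiplicity. The exchanges of a shortest path can be carried
out one by one from its start: each of them keeps the remaining path, and all distances that matter
for it, intact (`Labelled.swapAt`). If there is no such path from any `a`, then the family is
optimal (`overlap_le_of_blocked`): for each `k`, the set `S` of the elements that are reachable from
`{c ≤ k}` is contained in `{c ≤ k + 1}`, and no arc leaves it, so each tree has as many elements in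
`S` as any forest can have (`card_inter_le_of_closed`). Hence no family has a larger sum of
multiplicities on `S`; by convexity of the square, these inequalities for all `k` imply optimality.

The algorithm is written with loops whose numbers of rounds are bounded by variables that are never
assigned to, so that polynomial running time is a matter of syntax (`exec_compile`), and a program
has a total function as its semantics. All searches have the same form: a bounded number of rounds,
each of which tries all candidates for an improvement, where an improvement lowers a potential. If
the number of rounds exceeds the initial potential, then no candidate is left at the end
(`Improves.loop`, `Reaches.loop`). This covers the connectivity test by marking vertices
(`mark_spec`), the computation of distances (`relax_spec`), the walk along a shortest path
(`walk_spec`), and the outermost loop (`improve_spec`). The initial trees arise from the whole graph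
by deletion of redundant edges (`trees_spec`).
-/

/-! ### Bases of a finite family of vectors -/

namespace VectorBases

open Submodule

/-- `T` indexes a basis of the span of the vector family `x`; the linear independence is stated as
"no vector of `T` is in the span of the others". -/
def IsBase (K : Type*) {ι M : Type*} [DecidableEq ι] [Field K] [AddCommGroup M] [Module K M]
    (x : ι → M) (T : Finset ι) : Prop :=
  (∀ f ∈ T, x f ∉ span K (x '' (T.erase f))) ∧ ∀ e, x e ∈ span K (x '' T)

/-- The element `f` of `T` can be exchanged for `e`, which is not in `T`. -/
def Arc (K : Type*) {ι M : Type*} [DecidableEq ι] [Field K] [AddCommGroup M] [Module K M]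
    (x : ι → M) (T : Finset ι) (e f : ι) : Prop :=
  f ∈ T ∧ e ∉ T ∧ x e ∉ span K (x '' (T.erase f))

section Exchange

variable {ι K M : Type*} [Field K] [AddCommGroup M] [Module K M] {x : ι → M} {T F : Finset ι}
  {e f g h : ι}

lemma span_image_mono {A B : Finset ι} (hAB : ∀ a ∈ A, x a ∈ span K (x '' B)) :
    span K (x '' A) ≤ span K (x '' B) := by
  rw [span_le]
  rintro _ ⟨a, ha, rfl⟩
  exact hAB a ha

lemma mem_span_image {A : Finset ι} (he : e ∈ A) : x e ∈ span K (x '' A) :=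
  subset_span ⟨e, he, rfl⟩

variable [DecidableEq ι]

lemma span_image_exchange {A : Finset ι} (he : x e ∈ span K (x '' (insert f A : Finset ι)))
    (he' : x e ∉ span K (x '' A)) : x f ∈ span K (x '' (insert e A : Finset ι)) := by
  rw [Finset.coe_insert, Set.image_insert_eq] at *
  exact mem_span_insert_exchange he he'

/-- The exchange of `f` for `e`. -/
def swap (T : Finset ι) (e f : ι) : Finset ι := insert e (T.erase f)

lemma IsBase.mem_span_swap (hT : IsBase K x T) (ha : Arc K x T e f) :
    x f ∈ span K (x '' (swap T e f)) := by
  refine span_image_exchange ?_ ha.2.2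
  rw [Finset.insert_erase ha.1]
  exact hT.2 e

lemma IsBase.swap (hT : IsBase K x T) (ha : Arc K x T e f) : IsBase K x (swap T e f) := by
  obtain ⟨hf, he, hs⟩ := ha
  refine ⟨fun h hh => ?_, fun a => ?_⟩
  · rcases eq_or_ne h e with rfl | hne
    · rwa [VectorBases.swap, Finset.erase_insert (by simp [he])]
    · have hh' : h ≠ f ∧ h ∈ T := by simpa [VectorBases.swap, hne] using hh
      have hE : (VectorBases.swap T e f).erase h = insert e ((T.erase f).erase h) := by
        rw [VectorBases.swap, Finset.erase_insert_of_ne hne.symm]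
      rw [hE]
      intro hc
      apply hs
      have h2 := span_image_exchange hc fun hc' => hT.1 h hh'.2 <|
        span_image_mono (fun a ha => mem_span_image (by
          simp only [Finset.mem_erase] at ha ⊢; tauto)) hc'
      rwa [Finset.insert_erase (by simp [hh'])] at h2
  · refine span_image_mono (A := T) (fun b hb => ?_) (hT.2 a)
    rcases eq_or_ne b f with rfl | hne
    · exact hT.mem_span_swap ⟨hf, he, hs⟩
    · exact mem_span_image (by simp [VectorBases.swap, hne, hb])

/-- An arc `g → h` survives the exchange of `f` for `e` unless `e → h` is an arc. -/
lemma Arc.swap_of_mem_span (hgh : Arc K x T g h) (hhf : h ≠ f) (hge : g ≠ e)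
    (hs : x e ∈ span K (x '' (T.erase h))) : Arc K x (swap T e f) g h := by
  obtain ⟨hh, hg, hgs⟩ := hgh
  refine ⟨by simp [swap, hhf, hh], by simp [swap, hge, hg], fun hc => hgs ?_⟩
  refine span_image_mono (fun a ha => ?_) hc
  simp only [swap, Finset.mem_erase, Finset.mem_insert] at ha
  rcases ha.2 with rfl | ha'
  · exact hs
  · exact mem_span_image (by simp [ha.1, ha'.2])

/-- An arc `g → h` that is created by the exchange of `f` for `e` comes from an arc `e → h`. -/
lemma mem_span_erase_swap (ha : Arc K x T e f) (hhe : h ≠ e)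
    (hes : x e ∈ span K (x '' (T.erase h))) (hgs : x g ∈ span K (x '' (T.erase h))) :
    x g ∈ span K (x '' ((swap T e f).erase h)) := by
  have hE : (swap T e f).erase h = insert e ((T.erase h).erase f) := by
    rw [swap, Finset.erase_insert_of_ne hhe.symm, Finset.erase_right_comm]
  rw [hE]
  refine span_image_mono (fun a haT => ?_) hgs
  rcases eq_or_ne a f with rfl | hne
  · refine span_image_exchange ?_ fun hc => ha.2.2 ?_
    · rwa [Finset.insert_erase haT]
    · exact span_image_mono (fun b hb => mem_span_image (by
          simp only [Finset.mem_erase] at hb ⊢; tauto)) hc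
  · exact mem_span_image (by simp only [Finset.mem_insert, Finset.mem_erase] at haT ⊢; tauto)

/-- If no arc of `T` leaves `S`, then no independent set has more elements in `S` than `T`. -/
lemma card_inter_le_of_closed [Fintype ι] (S : Finset ι) (hT : IsBase K x T) (hF : IsBase K x F)
    (hS : ∀ e ∈ S, ∀ f, Arc K x T e f → f ∈ S) : (F ∩ S).card ≤ (T ∩ S).card := by
  classical
  have hli : LinearIndependent K (fun e : (F ∩ S : Finset ι) => x e) := by
    rw [linearIndependent_iff_notMem_span]
    rintro ⟨e, he⟩ hc
    refine hF.1 e (Finset.mem_inter.1 he).1 (span_mono ?_ hc)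
    rintro _ ⟨⟨a, ha⟩, ha', rfl⟩
    refine ⟨a, ?_, rfl⟩
    simp only [Finset.coe_erase, Set.mem_sdiff, Set.mem_singleton_iff, Set.mem_univ, true_and,
      Subtype.mk.injEq] at ha' ⊢
    exact ⟨(Finset.mem_inter.1 ha).1, ha'⟩
  -- elements of `T` outside `S` can be removed one by one without losing the span of `S`
  have key : ∀ R : Finset ι, R ⊆ T \ S → ∀ e ∈ S, x e ∈ span K (x '' (T \ R : Finset ι)) := by
    intro R
    induction R using Finset.induction_on with
    | empty => intro _ e _; simpa using hT.2 e
    | insert f R hfR ih =>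
      intro hR e heS
      have hf := Finset.mem_sdiff.1 (hR (Finset.mem_insert_self f R))
      by_cases heT : e ∈ T
      · refine mem_span_image ?_
        simp only [Finset.mem_sdiff, heT, true_and]
        exact fun hc => (Finset.mem_sdiff.1 (hR hc)).2 heS
      · by_contra hc
        have h1 := ih (fun a ha => hR (Finset.mem_insert_of_mem ha)) e heS
        have hE : T \ R = insert f (T \ insert f R) := by
          ext a
          simp only [Finset.mem_sdiff, Finset.mem_insert]
          constructor
          · rintro ⟨h1, h2⟩; tauto
          · rintro (rfl | h1)
            · exact ⟨hf.1, hfR⟩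
            · tauto
        rw [hE] at h1
        have h2 := span_image_exchange h1 hc
        -- the arc from `e` to `f` does not exist, hence `e` is spanned without `f`
        have h3 : x e ∈ span K (x '' (T.erase f)) := by
          by_contra h3
          exact hf.2 (hS e heS f ⟨hf.1, heT, h3⟩)
        refine hT.1 f hf.1 (span_image_mono (fun a ha => ?_) h2)
        rcases Finset.mem_insert.1 ha with rfl | ha
        · exact h3
        · refine mem_span_image ?_
          simp only [Finset.mem_sdiff, Finset.mem_insert, Finset.mem_erase] at ha ⊢
          tauto
  have hTS : T \ (T \ S) = T ∩ S := by ext a; simp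
  have h1 := linearIndependent_le_span_aux' _ hli (((T ∩ S).image x : Finset M) : Set M) ?_
  · simp only [Fintype.card_coe, Finset.coe_sort_coe] at h1
    exact h1.trans Finset.card_image_le
  · rintro _ ⟨⟨e, he⟩, rfl⟩
    have := key _ subset_rfl e (Finset.mem_inter.1 he).2
    rwa [hTS, ← Finset.coe_image] at this

end Exchange

/-! ### Families of bases with few overlaps -/

section Families

variable {ι κ K M : Type*}

/-- At a fixed point of the label updates, the labels below the cap are smaller than the number of
elements, as all smaller labels occur, too. -/
lemma label_lt_card [Fintype ι] {l : ι → ℕ} {B : ℕ}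
    (h : ∀ g, l g < B → l g ≠ 0 → ∃ h, l h + 1 = l g) {g : ι} (hg : l g < B) :
    l g < Fintype.card ι := by
  have key : ∀ d ≤ l g, ∃ a, l a + d = l g := by
    intro d
    induction d with
    | zero => exact fun _ => ⟨g, rfl⟩
    | succ d ih =>
      intro hd
      obtain ⟨a, ha⟩ := ih (by omega)
      obtain ⟨b, hb⟩ := h a (by omega) (by omega)
      exact ⟨b, by omega⟩
  have hsub : Finset.range (l g + 1) ⊆ Finset.univ.image l := fun t ht => by
    rw [Finset.mem_range] at ht
    obtain ⟨a, ha⟩ := key (l g - t) (by omega)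
    exact Finset.mem_image.2 ⟨a, Finset.mem_univ a, by omega⟩
  have := (Finset.card_le_card hsub).trans Finset.card_image_le
  rw [Finset.card_range, Finset.card_univ] at this
  omega

variable [DecidableEq ι] [Field K] [AddCommGroup M] [Module K M] {x : ι → M}

/-- The labels `l` are distances, along the arcs of the family `T`, to the elements with label `0`,
as far as they do not exceed `b`. During a walk along a shortest path, `b` is the label of the
current element, as larger labels may have become wrong. -/
structure Labelled (K : Type*) {ι κ M : Type*} [DecidableEq ι] [Field K] [AddCommGroup M]
    [Module K M] (x : ι → M) (l : ι → ℕ) (T : κ → Finset ι) (b : ℕ) : Prop where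
  le_succ : ∀ g i h, l g ≤ b → Arc K x (T i) g h → l g ≤ l h + 1
  exists_arc : ∀ g, l g ≤ b → l g ≠ 0 → ∃ i h, Arc K x (T i) g h ∧ l h + 1 = l g

/-- The family after the exchange of `f` for `e` in member `i`. -/
def swapAt [DecidableEq κ] (T : κ → Finset ι) (i : κ) (e f : ι) : κ → Finset ι :=
  Function.update T i (swap (T i) e f)

/-- An exchange along the first arc of a shortest path keeps all labels below correct, so the rest
of the path can be used without computing new labels. -/
lemma Labelled.swapAt [DecidableEq κ] {l : ι → ℕ} {T : κ → Finset ι} {e f : ι} {i : κ}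
    (hl : Labelled K x l T (l e)) (ha : Arc K x (T i) e f) (hf : l f + 1 = l e) :
    Labelled K x l (swapAt T i e f) (l f) := by
  constructor
  · intro g j h hg hgh
    by_cases hj : j = i
    · subst hj
      rw [VectorBases.swapAt, Function.update_self] at hgh
      by_cases hhe : h = e
      · subst hhe; omega
      have hh : h ≠ f ∧ h ∈ T j := by simpa [swap, hhe] using hgh.1
      -- an arc `g → h` that is new stems from an arc `e → h`, and `l e` exceeds `l g`
      by_cases hes : x e ∈ span K (x '' ((T j).erase h))
      · have hgs : x g ∉ span K (x '' ((T j).erase h)) := fun hgs =>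
          hgh.2.2 (mem_span_erase_swap ha hhe hes hgs)
        refine hl.le_succ g j h (by omega) ⟨hh.2, fun hgT => hgs (mem_span_image ?_), hgs⟩
        refine Finset.mem_erase.2 ⟨?_, hgT⟩
        rintro rfl
        exact hgh.2.1 hgh.1
      · have := hl.le_succ e j h le_rfl ⟨hh.2, ha.2.1, hes⟩
        omega
    · rw [VectorBases.swapAt, Function.update_of_ne hj] at hgh
      exact hl.le_succ g j h (by omega) hgh
  · intro g hg hg0
    obtain ⟨j, h, hgh, hlh⟩ := hl.exists_arc g (by omega) hg0
    refine ⟨j, h, ?_, hlh⟩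
    by_cases hj : j = i
    · subst hj
      rw [VectorBases.swapAt, Function.update_self]
      refine hgh.swap_of_mem_span ?_ ?_ ?_
      · rintro rfl; omega
      · rintro rfl; omega
      · -- an arc `e → h` would be a shortcut
        by_contra hes
        have := hl.le_succ e j h le_rfl ⟨hgh.1, ha.2.1, hes⟩
        omega
    · rwa [VectorBases.swapAt, Function.update_of_ne hj]

lemma IsBase.swapAt [DecidableEq κ] {T : κ → Finset ι} (hT : ∀ i, IsBase K x (T i)) {i : κ}
    {e f : ι} (ha : Arc K x (T i) e f) (j : κ) : IsBase K x (swapAt T i e f j) := by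
  by_cases hj : j = i
  · subst hj
    simpa [VectorBases.swapAt] using (hT j).swap ha
  · simpa [VectorBases.swapAt, hj] using hT j

variable [Fintype κ]

/-- The number of members of the family `T` that contain `e`. -/
def cnt (T : κ → Finset ι) (e : ι) : ℕ := (Finset.univ.filter fun i => e ∈ T i).card

/-- The objective: the sum of the squares of the multiplicities. -/
def overlap [Fintype ι] (T : κ → Finset ι) : ℕ := ∑ e, cnt T e ^ 2

/-- No sequence of exchanges raises the multiplicity of `a` at the expense of an element whose
multiplicity is greater by at least two; as witness, a set that is closed under arcs. -/
def Blocked (K : Type*) {ι κ M : Type*} [DecidableEq ι] [Fintype κ] [Field K] [AddCommGroup M]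
    [Module K M] (x : ι → M) (T : κ → Finset ι) (a : ι) : Prop :=
  ∃ U : Set ι, a ∈ U ∧ (∀ g ∈ U, ∀ i h, Arc K x (T i) g h → h ∈ U) ∧
    ∀ f ∈ U, cnt T f ≤ cnt T a + 1

lemma cnt_le_card (T : κ → Finset ι) (e : ι) : cnt T e ≤ Fintype.card κ :=
  Finset.card_le_univ _

lemma sum_cnt (T : κ → Finset ι) (S : Finset ι) : ∑ e ∈ S, cnt T e = ∑ i, (T i ∩ S).card := by
  simp only [cnt, Finset.card_eq_sum_ones, Finset.sum_filter]
  rw [Finset.sum_comm]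
  refine Finset.sum_congr rfl fun i _ => ?_
  rw [← Finset.sum_filter, Finset.filter_mem_eq_inter, Finset.inter_comm]

lemma sum_cnt_eq [Fintype ι] {T T' : κ → Finset ι} (hT : ∀ i, IsBase K x (T i))
    (hT' : ∀ i, IsBase K x (T' i)) : ∑ e, cnt T' e = ∑ e, cnt T e := by
  rw [sum_cnt, sum_cnt]
  exact Finset.sum_congr rfl fun i _ => le_antisymm
    (card_inter_le_of_closed _ (hT i) (hT' i) (by simp))
    (card_inter_le_of_closed _ (hT' i) (hT i) (by simp))

/-- Local optimality implies global optimality: the closed sets that witness it give, for each `k`,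
a set between `{c ≤ k}` and `{c ≤ k + 1}` on which the sum of the multiplicities `c` is as large
as possible. The number of these sets that contain `e` is, up to an affine change, a subgradient
of the square at `c e`. -/
theorem overlap_le_of_blocked [Fintype ι] {T T' : κ → Finset ι} (hT : ∀ i, IsBase K x (T i))
    (hT' : ∀ i, IsBase K x (T' i)) (hb : ∀ a, Blocked K x T a) : overlap T ≤ overlap T' := by
  classical
  choose U hU hcl hcnt using hb
  let S : ℕ → Finset ι := fun k => Finset.univ.filter fun e => ∃ a, cnt T a ≤ k ∧ e ∈ U a
  have hS : ∀ k, ∑ e ∈ S k, cnt T' e ≤ ∑ e ∈ S k, cnt T e := fun k => by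
    rw [sum_cnt, sum_cnt]
    refine Finset.sum_le_sum fun i _ => card_inter_le_of_closed _ (hT i) (hT' i) fun e he f ha => ?_
    simp only [S, Finset.mem_filter, Finset.mem_univ, true_and] at he ⊢
    obtain ⟨a, ha1, ha2⟩ := he
    exact ⟨a, ha1, hcl a e ha2 i f ha⟩
  set r := Fintype.card κ
  -- `p e` is `r - cnt T e` or `r - cnt T e + 1`, since `{c ≤ k} ⊆ S k ⊆ {c ≤ k + 1}`
  let p : ι → ℕ := fun e => ((Finset.range r).filter fun k => e ∈ S k).card
  have hp1 : ∀ e, r - cnt T e ≤ p e := fun e => by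
    rw [← Nat.card_Ico]
    refine Finset.card_le_card fun k hk => ?_
    rw [Finset.mem_Ico] at hk
    simp only [S, Finset.mem_filter, Finset.mem_univ, true_and, Finset.mem_range]
    exact ⟨hk.2, e, hk.1, hU e⟩
  have hp2 : ∀ e, p e ≤ r - (cnt T e - 1) := fun e => by
    rw [← Nat.card_Ico]
    refine Finset.card_le_card fun k hk => ?_
    simp only [S, Finset.mem_filter, Finset.mem_univ, true_and, Finset.mem_range] at hk
    obtain ⟨hk, a, ha1, ha2⟩ := hk
    have := hcnt a e ha2
    rw [Finset.mem_Ico]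
    omega
  -- the subgradient inequality with the slope `2 r + 1 - 2 p e`, which is `2 c - 1` or `2 c + 1`
  have hpt : ∀ e, (cnt T e : ℤ) ^ 2 + (2 * r + 1) * ((cnt T' e : ℤ) - cnt T e)
      - 2 * (p e * ((cnt T' e : ℤ) - cnt T e)) ≤ (cnt T' e : ℤ) ^ 2 := fun e => by
    have h0 : cnt T e ≤ r := cnt_le_card T e
    have h1 := hp1 e
    have h2 := hp2 e
    generalize cnt T e = c at *
    generalize cnt T' e = c' at *
    have h3 : (p e : ℤ) = r - c ∨ (p e : ℤ) = r - c + 1 := by omega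
    have h4 : 0 ≤ ((c' : ℤ) - c) * ((c' : ℤ) - c - 1) := by
      rcases le_or_gt ((c' : ℤ) - c) 0 with h | h
      · exact mul_nonneg_of_nonpos_of_nonpos h (by omega)
      · exact mul_nonneg (by omega) (by omega)
    have h5 : 0 ≤ ((c' : ℤ) - c) * ((c' : ℤ) - c + 1) := by
      rcases lt_or_ge ((c' : ℤ) - c) 0 with h | h
      · exact mul_nonneg_of_nonpos_of_nonpos (by omega) (by omega)
      · exact mul_nonneg (by omega) (by omega)
    rcases h3 with h3 | h3 <;> rw [h3] <;> nlinarith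
  -- interchange of summation: `p e` counts the sets `S k` that contain `e`
  have hsum : ∑ e, (p e : ℤ) * ((cnt T' e : ℤ) - cnt T e) ≤ 0 := by
    have : ∀ e, (p e : ℤ) * ((cnt T' e : ℤ) - cnt T e) =
        ∑ k ∈ Finset.range r, if e ∈ S k then ((cnt T' e : ℤ) - cnt T e) else 0 := fun e => by
      rw [← Finset.sum_filter, Finset.sum_const, nsmul_eq_mul]
    simp only [this]
    rw [Finset.sum_comm]
    refine Finset.sum_nonpos fun k _ => ?_
    rw [← Finset.sum_filter, Finset.filter_mem_eq_inter, Finset.univ_inter, Finset.sum_sub_distrib]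
    have := hS k
    zify at this
    linarith
  have htot : ∑ e, ((cnt T' e : ℤ) - cnt T e) = 0 := by
    rw [Finset.sum_sub_distrib, sub_eq_zero]
    exact_mod_cast sum_cnt_eq hT hT'
  have := Finset.sum_le_sum fun e (_ : e ∈ Finset.univ) => hpt e
  rw [Finset.sum_sub_distrib, Finset.sum_add_distrib, ← Finset.mul_sum, ← Finset.mul_sum,
    htot] at this
  unfold overlap
  zify
  linarith

lemma cnt_swapAt [DecidableEq κ] {T : κ → Finset ι} {i : κ} {e f : ι} (hf : f ∈ T i)
    (he : e ∉ T i) (a : ι) :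
    cnt (swapAt T i e f) a + (if a = f then 1 else 0) = cnt T a + (if a = e then 1 else 0) := by
  have hfe : f ≠ e := by rintro rfl; exact he hf
  simp only [cnt, Finset.card_filter]
  rw [← Finset.add_sum_erase _ _ (Finset.mem_univ i),
    ← Finset.add_sum_erase _ _ (Finset.mem_univ i)]
  have : ∑ j ∈ Finset.univ.erase i, (if a ∈ swapAt T i e f j then 1 else 0) =
      ∑ j ∈ Finset.univ.erase i, if a ∈ T j then 1 else 0 :=
    Finset.sum_congr rfl fun j hj => by
      rw [swapAt, Function.update_of_ne (Finset.ne_of_mem_erase hj)]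
  rw [this]
  simp only [swapAt, Function.update_self, swap, Finset.mem_insert, Finset.mem_erase]
  by_cases h1 : a = f
  · subst h1
    simp [hf, hfe]
    omega
  · by_cases h2 : a = e
    · subst h2
      simp [he, h1]
      omega
    · simp [h1, h2]

/-- Moving one unit of multiplicity from `f` to `a` lowers the objective. -/
lemma overlap_lt [Fintype ι] {T T' : κ → Finset ι} {a f : ι} (hf : cnt T a + 2 ≤ cnt T f)
    (h : ∀ e, cnt T' e + (if e = f then 1 else 0) = cnt T e + (if e = a then 1 else 0)) :
    overlap T' < overlap T := by
  have haf : a ≠ f := by rintro rfl; omega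
  unfold overlap
  rw [← Finset.add_sum_erase _ _ (Finset.mem_univ a),
    ← Finset.add_sum_erase _ _ (Finset.mem_univ a),
    ← Finset.add_sum_erase _ _ (Finset.mem_erase.2 ⟨haf.symm, Finset.mem_univ f⟩),
    ← Finset.add_sum_erase _ _ (Finset.mem_erase.2 ⟨haf.symm, Finset.mem_univ f⟩)]
  have hrest : ∑ e ∈ (Finset.univ.erase a).erase f, cnt T' e ^ 2 =
      ∑ e ∈ (Finset.univ.erase a).erase f, cnt T e ^ 2 := by
    refine Finset.sum_congr rfl fun e he => ?_
    have := h e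
    simp only [Finset.mem_erase, Finset.mem_univ, and_true] at he
    simp only [he.1, he.2, if_false] at this
    rw [show cnt T' e = cnt T e by omega]
  have ha := h a
  have hf' := h f
  simp only [haf, haf.symm, if_true, if_false] at ha hf'
  rw [hrest, show cnt T' a = cnt T a + 1 by omega, show cnt T f = cnt T' f + 1 by omega]
  have : cnt T a + 1 ≤ cnt T' f := by omega
  nlinarith

/-- If labels `l` with cap `B` are a fixed point of the label updates and `a` got no label, then `a`
is blocked, by the set of all elements without a label. That `B` exceeds the number of elements
excludes the label `B - 1`: otherwise an arc could lead from an element without a label to one with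
the label `B - 1`. -/
lemma blocked_of_label_eq [Fintype ι] {l : ι → ℕ} {B : ℕ} {T : κ → Finset ι} {a : ι}
    (hB : Fintype.card ι < B) (h0 : ∀ g, cnt T a + 2 ≤ cnt T g → l g = 0)
    (h1 : ∀ g i h, Arc K x (T i) g h → l g ≤ l h + 1)
    (h2 : ∀ g, l g < B → l g ≠ 0 → ∃ i h, Arc K x (T i) g h ∧ l h + 1 = l g) (ha : B ≤ l a) :
    Blocked K x T a := by
  refine ⟨{g | B ≤ l g}, ha, fun g hg i h hgh => ?_, fun f hf => ?_⟩
  · by_contra hc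
    have hc : l h < B := not_le.1 hc
    have h3 := label_lt_card (fun g hg hg0 => let ⟨_, h, hh⟩ := h2 g hg hg0; ⟨h, hh.2⟩) hc
    have := h1 g i h hgh
    simp only [Set.mem_ofPred_eq] at hg
    omega
  · by_contra hc
    have := h0 f (by omega)
    simp only [Set.mem_ofPred_eq] at hf
    omega

/-- If `a` is blocked, then it gets no label. -/
lemma label_ge_of_blocked {l : ι → ℕ} {B : ℕ} {T : κ → Finset ι} {a : ι} (hb : Blocked K x T a)
    (h0 : ∀ g, l g = 0 → cnt T a + 2 ≤ cnt T g)
    (h2 : ∀ g, l g < B → l g ≠ 0 → ∃ i h, Arc K x (T i) g h ∧ l h + 1 = l g) : B ≤ l a := by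
  obtain ⟨U, haU, hcl, hU⟩ := hb
  have key : ∀ d, ∀ g ∈ U, l g = d → B ≤ d := by
    intro d
    induction d with
    | zero =>
      intro g hg hd
      have := h0 g hd
      have := hU g hg
      omega
    | succ d ih =>
      intro g hg hd
      by_contra hc
      obtain ⟨i, h, hgh, hh⟩ := h2 g (by omega) (by omega)
      have := ih h (hcl g hg i h hgh) (by omega)
      omega
  exact key _ a haU rfl

end Families

end VectorBases

/-! ### Programs with bounded loops -/

namespace RAM

@[simp] lemma State.var_setVar (s : State) (x v y : ℕ) :
    (s.setVar x v).var y = if y = x then v else s.var y := by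
  simp [State.setVar, Function.update_apply]

@[simp] lemma State.arr_setVar (s : State) (x v : ℕ) : (s.setVar x v).arr = s.arr := rfl

@[simp] lemma State.var_setArr (s : State) (a i v : ℕ) : (s.setArr a i v).var = s.var := rfl

@[simp] lemma State.arr_setArr (s : State) (a i v b : ℕ) :
    (s.setArr a i v).arr b = if b = a then Function.update (s.arr a) i v else s.arr b := by
  simp only [State.setArr, Function.update_apply]

/-- Programs in which every loop runs a variable `x` through the numbers below the value of a
variable `b`. -/
inductive ForProgram where
  | skip
  | assign (x : ℕ) (e : Expr)
  | store (a : ℕ) (i e : Expr)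
  | seq (c d : ForProgram)
  | branch (e : Expr) (c d : ForProgram)
  | loop (x b : ℕ) (c : ForProgram)

namespace ForProgram

/-- `iter f x k s` is the state after `k` rounds of a loop with counter `x` and body `f`. -/
def iter (f : State → State) (x : ℕ) : ℕ → State → State
  | 0, s => s.setVar x 0
  | k + 1, s => (f (iter f x k s)).setVar x (k + 1)

/-- The final state as a function of the initial state. This is what the translated program computes
if the body of a loop never assigns to the counter or the bound of the loop. -/
def den : ForProgram → State → State
  | skip, s => s
  | assign x e, s => s.setVar x (e.eval s)
  | store a i e, s => s.setArr a (i.eval s) (e.eval s)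
  | seq c d, s => d.den (c.den s)
  | branch e c d, s => if e.eval s ≠ 0 then c.den s else d.den s
  | loop x b c, s => iter c.den x (s.var b) s

lemma den_seq (c d : ForProgram) (s : State) : (seq c d).den s = d.den (c.den s) := rfl

lemma den_assign (x : ℕ) (e : Expr) (s : State) : (assign x e).den s = s.setVar x (e.eval s) := rfl

lemma den_store (a : ℕ) (i e : Expr) (s : State) :
    (store a i e).den s = s.setArr a (i.eval s) (e.eval s) := rfl

lemma den_branch (e : Expr) (c d : ForProgram) (s : State) :
    (branch e c d).den s = if e.eval s ≠ 0 then c.den s else d.den s := rfl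

lemma den_skip (s : State) : skip.den s = s := rfl

/-- Translation into a program of the machine. -/
def compile : ForProgram → Program
  | skip => .skip
  | assign x e => .assign x e
  | store a i e => .store a i e
  | seq c d => .seq c.compile d.compile
  | branch e c d => .branch e c.compile d.compile
  | loop x b c => .seq (.assign x (.const 0)) <|
      .loop (.lt (.var x) (.var b)) (.seq c.compile (.assign x (.add (.var x) (.const 1))))

/-- The variables that are assigned to. -/
def vars : ForProgram → List ℕ
  | skip => []
  | assign x _ => [x]
  | store _ _ _ => []
  | seq c d => c.vars ++ d.vars
  | branch _ c d => c.vars ++ d.vars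
  | loop x _ c => x :: c.vars

/-- The arrays that are written to. -/
def arrs : ForProgram → List ℕ
  | skip => []
  | assign _ _ => []
  | store a _ _ => [a]
  | seq c d => c.arrs ++ d.arrs
  | branch _ c d => c.arrs ++ d.arrs
  | loop _ _ c => c.arrs

/-- The variables that bound a loop. -/
def bounds : ForProgram → List ℕ
  | skip => []
  | assign _ _ => []
  | store _ _ _ => []
  | seq c d => c.bounds ++ d.bounds
  | branch _ c d => c.bounds ++ d.bounds
  | loop _ b c => b :: c.bounds

/-- No loop counter is assigned to in the body of its loop. -/
def CountersOk : ForProgram → Bool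
  | skip => true
  | assign _ _ => true
  | store _ _ _ => true
  | seq c d => c.CountersOk && d.CountersOk
  | branch _ c d => c.CountersOk && d.CountersOk
  | loop x _ c => !(c.vars.contains x) && c.CountersOk

/-- A bound for the number of steps, as a polynomial in a bound for the values of the variables
that bound loops. -/
noncomputable def cost : ForProgram → Polynomial ℕ
  | skip => 1
  | assign _ e => .C (e.cost + 1)
  | store _ i e => .C (i.cost + e.cost + 1)
  | seq c d => c.cost + d.cost
  | branch e c d => .C (e.cost + 1) + c.cost + d.cost
  | loop _ _ c => 6 + .X * (c.cost + 8)

lemma den_var {c : ForProgram} {y : ℕ} (hy : y ∉ c.vars) (s : State) :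
    (c.den s).var y = s.var y := by
  induction c generalizing s with
  | skip => rfl
  | assign x e => simp_all [den, vars]
  | store a i e => rfl
  | seq c d ihc ihd => simp_all [den, vars]
  | branch e c d ihc ihd =>
    simp only [vars, List.mem_append, not_or] at hy
    simp only [den]
    split_ifs
    · exact ihc hy.1 s
    · exact ihd hy.2 s
  | loop x b c ih =>
    simp only [vars, List.mem_cons, not_or] at hy
    have key : ∀ k, (iter c.den x k s).var y = s.var y := by
      intro k
      induction k with
      | zero => simp [iter, hy.1]
      | succ k ihk => simp [iter, hy.1, ih hy.2, ihk]
    exact key _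

lemma den_arr {c : ForProgram} {a : ℕ} (ha : a ∉ c.arrs) (s : State) :
    (c.den s).arr a = s.arr a := by
  induction c generalizing s with
  | skip => rfl
  | assign x e => rfl
  | store b i e => simp_all [den, arrs]
  | seq c d ihc ihd => simp_all [den, arrs]
  | branch e c d ihc ihd =>
    simp only [arrs, List.mem_append, not_or] at ha
    simp only [den]
    split_ifs
    · exact ihc ha.1 s
    · exact ihd ha.2 s
  | loop x b c ih =>
    have key : ∀ k, (iter c.den x k s).arr a = s.arr a := by
      intro k
      induction k with
      | zero => simp [iter]
      | succ k ihk => simp [iter, ih ha, ihk]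
    exact key _

/-- Programs with bounded loops run in polynomial time and compute `den`. -/
theorem exec_compile {c : ForProgram} (hc : c.CountersOk = true)
    (hb : ∀ b ∈ c.bounds, b ∉ c.vars) {B : ℕ} (s : State) (hB : ∀ b ∈ c.bounds, s.var b ≤ B) :
    ∃ t ≤ c.cost.eval B, Exec c.compile s t (c.den s) := by
  induction c generalizing s with
  | skip => exact ⟨1, by simp [cost], .skip s⟩
  | assign x e => exact ⟨_, by simp [cost], .assign s x e⟩
  | store a i e => exact ⟨_, by simp [cost], .store s a i e⟩
  | seq c d ihc ihd =>
    simp only [CountersOk, Bool.and_eq_true, bounds, vars, List.mem_append, not_or] at hc hb hB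
    obtain ⟨t₁, h₁, e₁⟩ := ihc hc.1 (fun b h => (hb b (.inl h)).1) s fun b h => hB b (.inl h)
    obtain ⟨t₂, h₂, e₂⟩ := ihd hc.2 (fun b h => (hb b (.inr h)).2) (c.den s) fun b h => by
      rw [den_var (hb b (.inr h)).1]
      exact hB b (.inr h)
    exact ⟨t₁ + t₂, by simp only [cost, Polynomial.eval_add]; omega, .seq e₁ e₂⟩
  | branch e c d ihc ihd =>
    simp only [CountersOk, Bool.and_eq_true, bounds, vars, List.mem_append, not_or] at hc hb hB
    obtain ⟨t₁, h₁, e₁⟩ := ihc hc.1 (fun b h => (hb b (.inl h)).1) s fun b h => hB b (.inl h)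
    obtain ⟨t₂, h₂, e₂⟩ := ihd hc.2 (fun b h => (hb b (.inr h)).2) s fun b h => hB b (.inr h)
    simp only [den, cost, Polynomial.eval_add, Polynomial.eval_C]
    split_ifs with he
    · exact ⟨_, by omega, .branch_true he e₁⟩
    · exact ⟨_, by omega, .branch_false (not_not.1 he) e₂⟩
  | loop x b c ih =>
    simp only [CountersOk, Bool.and_eq_true, Bool.not_eq_true', List.contains_eq_mem,
      decide_eq_false_iff_not, bounds, vars, List.mem_cons, not_or, forall_eq_or_imp] at hc hb hB
    set N := s.var b with hN
    have hvar : ∀ k, (iter c.den x k s).var b = N := by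
      intro k
      induction k with
      | zero => simp [iter, hb.1.1, hN]
      | succ k ihk => simp [iter, hb.1.1, den_var hb.1.2, ihk]
    have hle : ∀ k, ∀ b' ∈ c.bounds, (iter c.den x k s).var b' ≤ B := by
      intro k b' hb'
      have h := hb.2 b' hb'
      induction k with
      | zero => simpa [iter, h.1] using hB.2 b' hb'
      | succ k ihk => simpa [iter, h.1, den_var h.2] using ihk
    have hx : ∀ k, (iter c.den x k s).var x = k := by
      intro k
      cases k <;> simp [iter]
    -- execution of the remaining `d` rounds of the loop
    have key : ∀ d k, k + d = N → ∃ t ≤ 4 + d * (c.cost.eval B + 8),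
        Exec (.loop (.lt (.var x) (.var b)) (.seq c.compile (.assign x (.add (.var x) (.const 1)))))
          (iter c.den x k s) t (iter c.den x N s) := by
      intro d
      induction d with
      | zero =>
        rintro k rfl
        refine ⟨_, ?_, .loop_done ?_⟩
        · simp [Expr.cost]
        · simp [Expr.eval, hx, hvar]
      | succ d ihd =>
        intro k hk
        obtain ⟨t₁, h₁, e₁⟩ := ih hc.2 (fun b' h => (hb.2 b' h).2) (iter c.den x k s) (hle k)
        obtain ⟨t₂, h₂, e₂⟩ := ihd (k + 1) (by omega)
        have e₃ := Exec.seq e₁ (.assign _ x (.add (.var x) (.const 1)))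
        have hst : (c.den (iter c.den x k s)).setVar x
            (Expr.eval (c.den (iter c.den x k s)) (.add (.var x) (.const 1))) =
            iter c.den x (k + 1) s := by
          simp [iter, Expr.eval, den_var hc.1, hx]
        rw [hst] at e₃
        refine ⟨_, ?_, .loop_step ?_ e₃ e₂⟩
        · simp only [Expr.cost]
          rw [add_mul]
          omega
        · simp only [Expr.eval, hx, hvar]
          rw [if_pos (by omega)]
          exact one_ne_zero
    obtain ⟨t, ht, et⟩ := key N 0 (by omega)
    refine ⟨_, ?_, .seq (.assign s x (.const 0)) et⟩
    have h1 : N * (c.cost.eval B + 8) ≤ B * (c.cost.eval B + 8) := Nat.mul_le_mul_right _ hB.1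
    simp only [cost, Expr.cost, Polynomial.eval_add, Polynomial.eval_mul, Polynomial.eval_X,
      Polynomial.eval_ofNat]
    omega

/-- Loop invariants: `I k` holds before round `k`, when the counter is `k`. Setting the counter to
`k + 1` is part of the round. -/
theorem loop_invariant {x b : ℕ} {c : ForProgram} {s : State} (I : ℕ → State → Prop)
    (h0 : I 0 (s.setVar x 0))
    (hs : ∀ k s', k < s.var b → s'.var x = k → I k s' → I (k + 1) ((c.den s').setVar x (k + 1))) :
    I (s.var b) ((loop x b c).den s) := by
  have key : ∀ k ≤ s.var b, I k (iter c.den x k s) := by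
    intro k
    induction k with
    | zero => exact fun _ => h0
    | succ k ih =>
      exact fun hk => hs k _ (by omega) (by cases k <;> simp [iter]) (ih (by omega))
  exact key _ le_rfl

/-! ### Programs that improve a potential -/

section Improve

variable {α : Type*} {J : State → Prop} {core : State → α} {μ : α → ℕ}

/-- The program `c` maintains the invariant `J`, and unless the relevant part `core` of the memory
satisfies `C`, in which case `core` does not change, it lowers the potential `μ`. -/
def Improves (c : ForProgram) (J : State → Prop) (core : State → α) (μ : α → ℕ) (C : α → Prop) :
    Prop :=
  ∀ s, J s → J (c.den s) ∧ (C (core s) → core (c.den s) = core s) ∧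
    (¬ C (core s) → μ (core (c.den s)) < μ (core s))

/-- The program `c` maintains the invariant `J`, and it ends up with `C` or lowers the potential
by at least `d`. -/
def Reaches (d : ℕ) (c : ForProgram) (J : State → Prop) (core : State → α) (μ : α → ℕ)
    (C : α → Prop) : Prop :=
  ∀ s, J s → J (c.den s) ∧ (C (core s) → core (c.den s) = core s) ∧
    (C (core (c.den s)) ∨ μ (core (c.den s)) + d ≤ μ (core s))

/-- A loop over all candidates `k` for an improvement: it stops improving only if there is no
candidate left. -/
theorem Improves.loop {x b N : ℕ} {c : ForProgram} {C : Fin N → α → Prop}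
    (hJ : ∀ s k, J s → J (s.setVar x k)) (hcore : ∀ s k, core (s.setVar x k) = core s)
    (hN : ∀ s, J s → s.var b = N)
    (h : ∀ k : Fin N, Improves c (fun s => J s ∧ s.var x = k) core μ (C k)) :
    Improves (.loop x b c) J core μ (fun a => ∀ k, C k a) := by
  intro s hs
  have := loop_invariant (x := x) (b := b) (c := c) (s := s) (fun k s' => J s' ∧
    ((∀ j : Fin N, (j : ℕ) < k → C j (core s)) → core s' = core s) ∧
    ((¬ ∀ j : Fin N, (j : ℕ) < k → C j (core s)) → μ (core s') < μ (core s)))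
    ⟨hJ _ _ hs, fun _ => hcore _ _, fun hc => absurd (fun j hj => absurd hj (by omega)) hc⟩ ?_
  · obtain ⟨h1, h2, h3⟩ := this
    rw [hN s hs] at h2 h3
    exact ⟨h1, fun hc => h2 fun j _ => hc j, fun hc => h3 fun hc' => hc fun j => hc' j j.2⟩
  · rintro k s' hk hx ⟨h1, h2, h3⟩
    rw [hN s hs] at hk
    obtain ⟨⟨g1, -⟩, g2, g3⟩ := h ⟨k, hk⟩ s' ⟨h1, hx⟩
    refine ⟨hJ _ _ g1, fun hc => ?_, fun hc => ?_⟩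
    · have e := h2 fun j hj => hc j (by omega)
      rw [hcore, g2 (by rw [e]; exact hc ⟨k, hk⟩ (by simp)), e]
    · rw [hcore]
      by_cases hc' : ∀ j : Fin N, (j : ℕ) < k → C j (core s)
      · have e := h2 hc'
        have : ¬ C ⟨k, hk⟩ (core s') := fun hC => hc fun j hj => by
          rcases Nat.lt_succ_iff_lt_or_eq.1 hj with hj | hj
          · exact hc' j hj
          · rw [← e, show j = ⟨k, hk⟩ from Fin.ext hj]
            exact hC
        have := g3 this
        rwa [e] at this
      · have e := h3 hc'
        by_cases hC : C ⟨k, hk⟩ (core s')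
        · rwa [g2 hC]
        · exact (g3 hC).trans e

theorem Improves.reaches {c : ForProgram} {C : α → Prop} (h : Improves c J core μ C) :
    Reaches 1 c J core μ C := fun s hs => by
  obtain ⟨h1, h2, h3⟩ := h s hs
  refine ⟨h1, h2, ?_⟩
  by_cases hc : C (core s)
  · rw [h2 hc]; exact .inl hc
  · exact .inr (h3 hc)

theorem Reaches.loop {x b N d : ℕ} {c : ForProgram} {C : α → Prop}
    (hJ : ∀ s k, J s → J (s.setVar x k)) (hcore : ∀ s k, core (s.setVar x k) = core s)
    (hN : ∀ s, J s → s.var b = N) (h : Reaches d c J core μ C) :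
    Reaches (N * d) (.loop x b c) J core μ C := by
  intro s hs
  rw [← hN s hs]
  refine loop_invariant (x := x) (b := b) (c := c) (s := s) (fun k s' => J s' ∧
    (C (core s) → core s' = core s) ∧ (C (core s') ∨ μ (core s') + k * d ≤ μ (core s)))
    ⟨hJ _ _ hs, fun _ => hcore _ _, .inr (by simp [hcore])⟩ ?_
  rintro k s' - - ⟨h1, h2, h3⟩
  obtain ⟨g1, g2, g3⟩ := h s' h1
  refine ⟨hJ _ _ g1, fun hc => ?_, ?_⟩
  · have e := h2 hc
    rw [hcore, g2 (by rwa [e]), e]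
  · rw [hcore, add_mul]
    rcases h3 with h3 | h3
    · rw [g2 h3]; exact .inl h3
    · exact g3.imp_right fun g3 => by omega

end Improve

end ForProgram

end RAM

/-! ### Connectivity by marking vertices -/

namespace DiverseTrees

open RAM RAM.ForProgram VectorBases Submodule

variable {n m r : ℕ}

/-- The row of the incidence matrix for the edge `u k, v k`, as a functional on the potentials on
the vertices. A family of edges is a spanning forest if these rows form a basis. -/
def edgeVec (u v : Fin m → Fin n) (k : Fin m) : Module.Dual ℚ (Fin n → ℚ) :=
  (LinearMap.proj (u k) : (Fin n → ℚ) →ₗ[ℚ] ℚ) - LinearMap.proj (v k)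

/-- An edge is spanned by `A` if and only if every potential that is constant along the edges of `A`
is constant along it. -/
lemma edgeVec_mem_span_iff {u v : Fin m → Fin n} {A : Finset (Fin m)} {e : Fin m} :
    edgeVec u v e ∈ span ℚ (edgeVec u v '' A) ↔
      ∀ χ : Fin n → ℚ, (∀ g ∈ A, χ (u g) = χ (v g)) → χ (u e) = χ (v e) := by
  constructor
  · intro h χ hχ
    have : span ℚ (edgeVec u v '' A) ≤ LinearMap.ker (Module.Dual.eval ℚ (Fin n → ℚ) χ) := by
      rw [span_le]
      rintro _ ⟨g, hg, rfl⟩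
      simpa [edgeVec, sub_eq_zero] using hχ g hg
    simpa [edgeVec, sub_eq_zero] using this h
  · intro h
    have := mem_span_of_iInf_ker_le_ker (L := fun g : (A : Set (Fin m)) => edgeVec u v g)
      (K := edgeVec u v e) fun χ hχ => by
        simp only [mem_iInf, LinearMap.mem_ker, Subtype.forall] at hχ
        have := h χ fun g hg => by simpa [edgeVec, sub_eq_zero] using hχ g hg
        simpa [edgeVec, sub_eq_zero] using this
    rwa [Set.image_eq_range]

/-- The family of `r` sets of edges whose characteristic vectors are stored one after the other in
the array `a`. -/
def rows (m r : ℕ) (a : ℕ → ℕ) (i : Fin r) : Finset (Fin m) :=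
  Finset.univ.filter fun k => a (i * m + k) ≠ 0

lemma mem_rows {a : ℕ → ℕ} {i : Fin r} {k : Fin m} : k ∈ rows m r a i ↔ a (i * m + k) ≠ 0 := by
  simp [rows]

/-- The read-only part of the memory: the variables `2, 3, 4, 5` hold `n`, `m`, `r` and
`n + m + r + 1`, array `0` holds the input, and array `2` the offsets of the characteristic vectors,
which are in array `1`.

The rest of the memory is used as follows. Variable `1` holds the length of the output; the
variables `6`, `7`, `8` hold a row, an edge that may enter it and an edge that may leave it;
variable `9` holds the edge whose multiplicity is to be raised; the variables from `10` on are local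
to the connectivity test (`10, 11, 12`) or count rounds. The arrays `3`, `4`, `5` hold marks of
vertices, labels of edges and multiplicities of edges. -/
structure Env (r : ℕ) (u v : Fin m → Fin n) (s : State) : Prop where
  var_n : s.var 2 = n
  var_m : s.var 3 = m
  var_r : s.var 4 = r
  var_b : s.var 5 = n + m + r + 1
  arr_u : ∀ k : Fin m, s.arr 0 (3 + (k + k)) = u k
  arr_v : ∀ k : Fin m, s.arr 0 (4 + (k + k)) = v k
  arr_off : ∀ i : Fin r, s.arr 2 i = i * m

variable {u v : Fin m → Fin n} {s : State}

lemma Env.of_eq {s' : State} (hs : Env r u v s) (h2 : s'.var 2 = s.var 2)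
    (h3 : s'.var 3 = s.var 3) (h4 : s'.var 4 = s.var 4) (h5 : s'.var 5 = s.var 5)
    (ha : s'.arr 0 = s.arr 0) (hb : s'.arr 2 = s.arr 2) : Env r u v s' :=
  ⟨h2 ▸ hs.var_n, h3 ▸ hs.var_m, h4 ▸ hs.var_r, h5 ▸ hs.var_b, ha ▸ hs.arr_u, ha ▸ hs.arr_v,
    hb ▸ hs.arr_off⟩

lemma Env.setVar (hs : Env r u v s) {x : ℕ} (hx : 5 < x) (k : ℕ) : Env r u v (s.setVar x k) := by
  refine hs.of_eq ?_ ?_ ?_ ?_ rfl rfl <;> rw [State.var_setVar, if_neg (by omega)]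

lemma Env.setArr (hs : Env r u v s) {a : ℕ} (h0 : a ≠ 0) (h2 : a ≠ 2) (i k : ℕ) :
    Env r u v (s.setArr a i k) := by
  refine hs.of_eq rfl rfl rfl rfl ?_ ?_ <;> rw [State.arr_setArr, if_neg (by omega)]

lemma Env.den (hs : Env r u v s) (c : ForProgram)
    (hc : ((∀ x ∈ c.vars, 5 < x) ∧ 0 ∉ c.arrs ∧ 2 ∉ c.arrs) := by decide) :
    Env r u v (c.den s) :=
  hs.of_eq (den_var (fun h => absurd (hc.1 _ h) (by omega)) s)
    (den_var (fun h => absurd (hc.1 _ h) (by omega)) s)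
    (den_var (fun h => absurd (hc.1 _ h) (by omega)) s)
    (den_var (fun h => absurd (hc.1 _ h) (by omega)) s) (den_arr hc.2.1 s) (den_arr hc.2.2 s)

/-- The address, in array `1`, of the entry for the edge in variable `e` of the characteristic
vector whose number is in variable `i`. -/
def address (i e : ℕ) : Expr := .add (.read 2 (.var i)) (.var e)

/-- The entry at that address. -/
def entry (i e : ℕ) : Expr := .read 1 (address i e)

/-- The first end of the edge in variable `e`. -/
def fstEnd (e : ℕ) : Expr := .read 0 (.add (.const 3) (.add (.var e) (.var e)))

/-- The second end of the edge in variable `e`. -/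
def sndEnd (e : ℕ) : Expr := .read 0 (.add (.const 4) (.add (.var e) (.var e)))

lemma Env.eval_address (hs : Env r u v s) {y z : ℕ} {i : Fin r} {e : Fin m} (hi : s.var y = i)
    (he : s.var z = e) : (address y z).eval s = i * m + e := by
  simp [address, Expr.eval, hi, he, hs.arr_off]

lemma Env.eval_entry (hs : Env r u v s) {y z : ℕ} {i : Fin r} {e : Fin m} (hi : s.var y = i)
    (he : s.var z = e) : (entry y z).eval s = s.arr 1 (i * m + e) := by
  simp [entry, address, Expr.eval, hi, he, hs.arr_off]

lemma Env.eval_fstEnd (hs : Env r u v s) {z : ℕ} {e : Fin m} (he : s.var z = e) :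
    (fstEnd z).eval s = u e := by
  simp [fstEnd, Expr.eval, he, hs.arr_u]

lemma Env.eval_sndEnd (hs : Env r u v s) {z : ℕ} {e : Fin m} (he : s.var z = e) :
    (sndEnd z).eval s = v e := by
  simp [sndEnd, Expr.eval, he, hs.arr_v]

/-- Marks, in array `3`, both ends of the edge in variable `12` if exactly one of them is marked and
the edge is in row `var 6` and is not the edge in variable `8`. -/
def markStep : ForProgram :=
  .branch (entry 6 12) (.branch (.eq (.var 12) (.var 8)) .skip
    (.branch (.eq (.read 3 (fstEnd 12)) (.read 3 (sndEnd 12))) .skip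
      (.seq (.store 3 (fstEnd 12) (.const 1)) (.store 3 (sndEnd 12) (.const 1))))) .skip

/-- Marks the vertices that are connected to the first end of the edge in variable `7` by edges in
row `var 6` other than the edge in variable `8`. -/
def mark : ForProgram :=
  .seq (.loop 10 2 (.store 3 (.var 10) (.const 0)))
    (.seq (.store 3 (fstEnd 7) (.const 1)) (.loop 11 2 (.loop 12 3 markStep)))

/-- The invariant for marking: all marked vertices are connected to `u e`. -/
def MarkInv (u v : Fin m → Fin n) (a : ℕ → ℕ) (i : Fin r) (e f : Fin m) (s : State) : Prop :=
  Env r u v s ∧ s.arr 1 = a ∧ s.var 6 = i ∧ s.var 8 = f ∧ s.arr 3 (u e) = 1 ∧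
    ∀ w : Fin n, s.arr 3 w = 0 ∨ s.arr 3 w = 1 ∧ ∀ χ : Fin n → ℚ,
      (∀ g ∈ (rows m r a i).erase f, χ (u g) = χ (v g)) → χ w = χ (u e)

/-- The number of unmarked vertices. -/
def unmarked (a : Fin n → ℕ) : ℕ := (Finset.univ.filter fun w => a w = 0).card

lemma improves_markStep (a : ℕ → ℕ) (i : Fin r) (e f g : Fin m) :
    Improves markStep (fun s => MarkInv u v a i e f s ∧ s.var 12 = g)
      (fun s (w : Fin n) => s.arr 3 w) unmarked
      (fun b => g ∈ (rows m r a i).erase f → b (u g) = b (v g)) := by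
  rintro s ⟨⟨hs, ha, hi, hf, hue, hw⟩, hg⟩
  simp only [markStep, den, hs.eval_entry hi hg, Expr.eval, hs.eval_fstEnd hg, hs.eval_sndEnd hg,
    hg, hf, ha, ne_eq, ite_not, ite_eq_right_iff, one_ne_zero, imp_false, Finset.mem_erase,
    mem_rows, Fin.val_inj]
  have hJ : MarkInv u v a i e f s ∧ s.var 12 = g := ⟨⟨hs, ha, hi, hf, hue, hw⟩, hg⟩
  by_cases h1 : a (i * m + g) = 0
  · simp [h1, hJ]
  by_cases h2 : g = f
  · simp [h2, h2 ▸ hJ]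
  by_cases h3 : s.arr 3 (u g) = s.arr 3 (v g)
  · simp [h1, h2, h3, hJ]
  simp only [h1, h2, h3, if_false, not_false_eq_true, and_self, forall_const, false_imp_iff,
    true_and]
  have hgm : g ∈ (rows m r a i).erase f := Finset.mem_erase.2 ⟨h2, mem_rows.2 h1⟩
  have hconn : ∀ χ : Fin n → ℚ, (∀ g ∈ (rows m r a i).erase f, χ (u g) = χ (v g)) →
      χ (u g) = χ (u e) ∧ χ (v g) = χ (u e) := fun χ hχ => by
    have := hχ g hgm
    rcases hw (u g) with h | ⟨h, h'⟩
    · rcases hw (v g) with k | ⟨k, k'⟩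
      · exact absurd (h.trans k.symm) h3
      · rw [this, k' χ hχ]; exact ⟨rfl, rfl⟩
    · rw [← this, h' χ hχ]; exact ⟨rfl, rfl⟩
  have hnew : ∀ w : ℕ, (((s.setArr 3 (u g) 1).setArr 3 (v g) 1).arr 3) w =
      if w = u g ∨ w = v g then 1 else s.arr 3 w := fun w => by
    simp only [State.arr_setArr, if_true, Function.update_apply]
    split_ifs <;> simp_all
  have hend : (sndEnd 12).eval (s.setArr 3 (u g) 1) = v g :=
    (hs.setArr (by omega) (by omega) _ _).eval_sndEnd hg
  rw [hend]
  refine ⟨⟨⟨(hs.setArr (by omega) (by omega) _ _).setArr (by omega) (by omega) _ _, ?_, hi, hf, ?_,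
    ?_⟩, hg⟩, ?_⟩
  · simpa using ha
  · rw [hnew]; split_ifs <;> simp [hue]
  · intro w
    rw [hnew]
    split_ifs with h
    · refine .inr ⟨rfl, fun χ hχ => ?_⟩
      rcases h with h | h
      · rw [Fin.ext h]; exact (hconn χ hχ).1
      · rw [Fin.ext h]; exact (hconn χ hχ).2
    · exact hw w
  · refine Finset.card_lt_card ⟨fun w hw => ?_, fun hc => h3 ?_⟩
    · simp only [Finset.mem_filter, Finset.mem_univ, true_and] at hw ⊢
      by_contra h
      rw [hnew] at hw
      split_ifs at hw
      exact h hw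
    · have key : ∀ w : Fin n, w = u g ∨ w = v g → s.arr 3 w ≠ 0 := fun w hw h0 => by
        have h4 := (Finset.mem_filter.1 (hc (Finset.mem_filter.2 ⟨Finset.mem_univ w, h0⟩))).2
        beta_reduce at h4
        rw [hnew, if_pos (by rcases hw with rfl | rfl <;> simp)] at h4
        exact one_ne_zero h4
      have h4 := (hw (u g)).resolve_left (key _ (.inl rfl))
      have h5 := (hw (v g)).resolve_left (key _ (.inr rfl))
      rw [h4.1, h5.1]

lemma MarkInv.setVar {a : ℕ → ℕ} {i : Fin r} {e f : Fin m} (hs : MarkInv u v a i e f s) {x : ℕ}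
    (hx : 8 < x) (k : ℕ) : MarkInv u v a i e f (s.setVar x k) := by
  obtain ⟨hs, ha, hi, hf, hue, hw⟩ := hs
  refine ⟨hs.setVar (by omega) _, ha, ?_, ?_, hue, hw⟩
  · rwa [State.var_setVar, if_neg (by omega)]
  · rwa [State.var_setVar, if_neg (by omega)]

/-- After marking, the second end of the edge `e` is marked if and only if `e` is in the span of the
edges in the given row other than `f`. -/
theorem mark_spec (hs : Env r u v s) {i : Fin r} {e f : Fin m} (hi : s.var 6 = i) (he : s.var 7 = e)
    (hf : s.var 8 = f) :
    (mark.den s).arr 3 (v e) ≠ 0 ↔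
      edgeVec u v e ∈ span ℚ (edgeVec u v '' ((rows m r (s.arr 1) i).erase f)) := by
  rw [edgeVec_mem_span_iff]
  set s₁ := (ForProgram.loop 10 2 (.store 3 (.var 10) (.const 0))).den s with h₁
  have hz : ∀ w < n, s₁.arr 3 w = 0 := by
    have := loop_invariant (x := 10) (b := 2) (c := .store 3 (.var 10) (.const 0)) (s := s)
      (fun k s' => ∀ w < k, s'.arr 3 w = 0) (by omega) (fun k s' _ hx h w hw => by
        simp only [den, Expr.eval, State.arr_setVar, State.arr_setArr, if_true, hx,
          Function.update_apply]
        split_ifs with h'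
        · rfl
        · exact h w (by omega))
    rwa [hs.var_n] at this
  have hs₁ : Env r u v s₁ := hs.den _
  have he₁ : s₁.var 7 = e := (den_var (by decide) _).trans he
  set s₂ := s₁.setArr 3 (u e) 1 with h₂
  have hs₂ : Env r u v s₂ := hs₁.setArr (by omega) (by omega) _ _
  have hinv : MarkInv u v (s.arr 1) i e f s₂ := by
    refine ⟨hs₂, ?_, (den_var (by decide) s).trans hi, (den_var (by decide) s).trans hf,
      by simp [h₂], fun w => ?_⟩
    · rw [h₂, State.arr_setArr, if_neg (by omega), h₁, den_arr (by decide)]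
    · simp only [h₂, State.arr_setArr, if_true, Function.update_apply, Fin.val_inj]
      split_ifs with h
      · exact .inr ⟨rfl, fun _ _ => by rw [h]⟩
      · exact .inl (hz w w.2)
  have hden : mark.den s = (ForProgram.loop 11 2 (.loop 12 3 markStep)).den s₂ := by
    rw [mark, den_seq, den_seq, ← h₁, den_store, hs₁.eval_fstEnd he₁, Expr.eval, h₂]
  have hR := ((Improves.loop (x := 12) (b := 3) (fun s k hs => hs.setVar (by omega) k)
    (fun _ _ => rfl) (fun s hs => hs.1.var_m)
    fun g => improves_markStep (u := u) (v := v) (s.arr 1) i e f g).reaches).loop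
    (x := 11) (b := 2) (fun s k hs => hs.setVar (by omega) k) (fun _ _ => rfl)
    (fun s hs => hs.1.var_n)
  obtain ⟨⟨-, -, -, -, hue, hw⟩, -, hC⟩ := hR s₂ hinv
  rw [← hden] at hue hw hC
  -- `u e` is marked from the start, so `n` rounds are enough
  have hμ : unmarked (fun w : Fin n => s₂.arr 3 w) < n := by
    conv_rhs => rw [← Fintype.card_fin n, ← Finset.card_univ]
    refine Finset.card_lt_card ⟨Finset.subset_univ _, fun hc => ?_⟩
    have := hc (Finset.mem_univ (u e))
    simp [h₂] at this
  have hC' := hC.resolve_right fun h => by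
    simp only [mul_one] at h
    omega
  constructor
  · intro hne χ hχ
    exact (((hw (v e)).resolve_left hne).2 χ hχ).symm
  · intro h h0
    -- the marks themselves are a potential
    have := h (fun w => ((mark.den s).arr 3 w : ℕ)) fun g hg => by exact_mod_cast hC' g hg
    rw [h0, hue] at this
    simp at this

/-! ### Initial spanning trees by deletion of redundant edges -/

lemma index_inj {i j : Fin r} {e f : Fin m} : (i : ℕ) * m + e = j * m + f ↔ i = j ∧ e = f := by
  constructor
  · intro h
    have he := e.2
    have hf := f.2
    have hij : (i : ℕ) = j := by
      have h1 : ((i : ℕ) * m + e) / m = i := by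
        rw [mul_comm, Nat.mul_add_div (by omega), Nat.div_eq_of_lt he, add_zero]
      have h2 : ((j : ℕ) * m + f) / m = j := by
        rw [mul_comm, Nat.mul_add_div (by omega), Nat.div_eq_of_lt hf, add_zero]
      rw [← h1, h, h2]
    rw [hij] at h
    exact ⟨Fin.ext hij, Fin.ext (by omega)⟩
  · rintro ⟨rfl, rfl⟩; rfl

lemma rows_update_zero (a : ℕ → ℕ) (i : Fin r) (e : Fin m) :
    rows m r (Function.update a (i * m + e) 0) =
      Function.update (rows m r a) i ((rows m r a i).erase e) := by
  ext j f
  by_cases hj : j = i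
  · subst hj
    rw [Function.update_self, Finset.mem_erase, mem_rows, mem_rows, Function.update_apply]
    by_cases hf : f = e <;> simp [Fin.val_inj, hf]
  · rw [Function.update_of_ne hj, mem_rows, mem_rows, Function.update_apply]
    simp [index_inj, hj]

lemma rows_update_one (a : ℕ → ℕ) (i : Fin r) (e : Fin m) :
    rows m r (Function.update a (i * m + e) 1) =
      Function.update (rows m r a) i (insert e (rows m r a i)) := by
  ext j f
  by_cases hj : j = i
  · subst hj
    rw [Function.update_self, Finset.mem_insert, mem_rows, mem_rows, Function.update_apply]
    by_cases hf : f = e <;> simp [Fin.val_inj, hf]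
  · rw [Function.update_of_ne hj, mem_rows, mem_rows, Function.update_apply]
    simp [index_inj, hj]

/-- The entries of the characteristic vectors are at most `1`. -/
def Bits (m r : ℕ) (a : ℕ → ℕ) : Prop := ∀ (i : Fin r) (k : Fin m), a (i * m + k) ≤ 1

lemma Bits.update {a : ℕ → ℕ} (h : Bits m r a) (j : ℕ) {b : ℕ} (hb : b ≤ 1) :
    Bits m r (Function.update a j b) := fun i k => by
  rw [Function.update_apply]
  split_ifs
  · exact hb
  · exact h i k

/-- Fills the characteristic vectors with ones. -/
def fill : ForProgram := .loop 6 4 (.loop 7 3 (.store 1 (address 6 7) (.const 1)))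

lemma fill_spec (hs : Env r u v s) (i : Fin r) (k : Fin m) :
    (fill.den s).arr 1 (i * m + k) = 1 := by
  have := loop_invariant (x := 6) (b := 4) (c := .loop 7 3 (.store 1 (address 6 7) (.const 1)))
    (s := s) (fun j s' => Env r u v s' ∧
      ∀ (i : Fin r) (k : Fin m), (i : ℕ) < j → s'.arr 1 (i * m + k) = 1)
    ⟨hs.setVar (by omega) _, fun _ _ h => absurd h (by omega)⟩ ?_
  · exact this.2 i k (hs.var_r ▸ i.2)
  rintro j s' hj hx ⟨hs', h⟩
  rw [hs.var_r] at hj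
  have := loop_invariant (x := 7) (b := 3) (c := .store 1 (address 6 7) (.const 1))
    (s := s') (fun l s' => Env r u v s' ∧ s'.var 6 = j ∧ ∀ (i : Fin r) (k : Fin m),
      ((i : ℕ) < j ∨ (i : ℕ) = j ∧ (k : ℕ) < l) → s'.arr 1 (i * m + k) = 1)
    ⟨hs'.setVar (by omega) _, by simpa using hx,
      fun i k hik => h i k (hik.resolve_right (by omega))⟩ ?_
  · rw [hs'.var_m] at this
    obtain ⟨h1, -, h2⟩ := this
    exact ⟨h1.setVar (by omega) _, fun i k hik => h2 i k (by have := k.2; omega)⟩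
  rintro l s'' hl hx ⟨hs'', h6, h⟩
  rw [hs'.var_m] at hl
  rw [den_store, hs''.eval_address (i := ⟨j, hj⟩) (e := ⟨l, hl⟩) h6 hx]
  refine ⟨(hs''.setArr (by omega) (by omega) _ _).setVar (by omega) _, by simpa using h6,
    fun i k hik => ?_⟩
  have hidx := @index_inj m r i ⟨j, hj⟩ k ⟨l, hl⟩
  simp only [Fin.ext_iff] at hidx
  simp only [State.arr_setVar, State.arr_setArr, if_true, Function.update_apply, hidx, Expr.eval]
  split_ifs with hc
  · rfl
  · exact h i k (by omega)

/-- Deletes the edge in variable `7` from row `var 6` if it is spanned by the other edges of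
that row. -/
def delete : ForProgram :=
  .seq (.assign 8 (.var 7)) (.seq mark
    (.branch (.read 3 (sndEnd 7)) (.store 1 (address 6 7) (.const 0)) .skip))

/-- Deletes redundant edges from all rows. -/
def trees : ForProgram := .loop 6 4 (.loop 7 3 delete)

/-- The invariant for the deletion of redundant edges: each row is spanning, and the edges that
satisfy `D` are not redundant in their row. -/
def TreesInv (u v : Fin m → Fin n) (D : Fin r → Fin m → Prop) (s : State) : Prop :=
  Env r u v s ∧ Bits m r (s.arr 1) ∧
    (∀ i e, edgeVec u v e ∈ span ℚ (edgeVec u v '' (rows m r (s.arr 1) i))) ∧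
    ∀ i f, D i f → f ∈ rows m r (s.arr 1) i →
      edgeVec u v f ∉ span ℚ (edgeVec u v '' ((rows m r (s.arr 1) i).erase f))

lemma TreesInv.setVar {D : Fin r → Fin m → Prop} (hs : TreesInv u v D s) {x : ℕ} (hx : 5 < x)
    (k : ℕ) : TreesInv u v D (s.setVar x k) :=
  ⟨hs.1.setVar hx k, hs.2⟩

lemma TreesInv.mono {D D' : Fin r → Fin m → Prop} (hs : TreesInv u v D s)
    (h : ∀ i e, D' i e → D i e) : TreesInv u v D' s :=
  ⟨hs.1, hs.2.1, hs.2.2.1, fun i f hif => hs.2.2.2 i f (h i f hif)⟩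

/-- An edge that is not redundant stays so when further edges are deleted. -/
lemma delete_spec {D : Fin r → Fin m → Prop} (hs : TreesInv u v D s) {i : Fin r} {e : Fin m}
    (hi : s.var 6 = i) (he : s.var 7 = e) :
    TreesInv u v (fun j f => D j f ∨ j = i ∧ f = e) (delete.den s) := by
  obtain ⟨hs, hb, hsp, hD⟩ := hs
  set s₁ := s.setVar 8 e with h₁
  have hs₁ : Env r u v s₁ := hs.setVar (by omega) _
  have hm := mark_spec hs₁ (i := i) (e := e) (f := e) (by simp [h₁, hi]) (by simp [h₁, he])
    (by simp [h₁])
  set s₂ := mark.den s₁ with h₂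
  have hs₂ : Env r u v s₂ := hs₁.den _
  have ha : s₂.arr 1 = s.arr 1 := den_arr (by decide) s₁
  have h6 : s₂.var 6 = i := (den_var (by decide) s₁).trans (by simp [h₁, hi])
  have h7 : s₂.var 7 = e := (den_var (by decide) s₁).trans (by simp [h₁, he])
  have hden : delete.den s = if s₂.arr 3 (v e) ≠ 0 then s₂.setArr 1 (i * m + e) 0 else s₂ := by
    rw [delete, den_seq, den_seq, den_assign, den_branch, den_store, den_skip]
    simp only [Expr.eval, he, ← h₁, ← h₂, hs₂.eval_sndEnd h7, hs₂.eval_address h6 h7]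
  rw [hden]
  have ha₁ : s₁.arr 1 = s.arr 1 := rfl
  rw [ha₁] at hm
  split_ifs with hc
  · have hsp' := hm.1 hc
    refine ⟨hs₂.setArr (by omega) (by omega) _ _, ?_, ?_⟩
    · simpa [ha] using hb.update _ (by omega)
    · simp only [State.arr_setArr, if_true, ha, rows_update_zero]
      constructor
      · intro j f
        by_cases hj : j = i
        · subst hj
          rw [Function.update_self]
          refine span_image_mono (fun a haj => ?_) (hsp j f)
          by_cases hae : a = e
          · rwa [hae]
          · exact mem_span_image (Finset.mem_erase.2 ⟨hae, haj⟩)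
        · rw [Function.update_of_ne hj]
          exact hsp j f
      · intro j f hjf
        by_cases hj : j = i
        · subst hj
          rw [Function.update_self]
          intro hf hc
          have hf' := Finset.mem_erase.1 hf
          refine hD j f (hjf.resolve_right fun h => hf'.1 h.2) hf'.2
            (span_image_mono (fun a ha => mem_span_image ?_) hc)
          simp only [Finset.mem_erase] at ha ⊢
          tauto
        · rw [Function.update_of_ne hj]
          exact hD j f (hjf.resolve_right fun h => hj h.1)
  · refine ⟨hs₂, ha ▸ hb, ha ▸ hsp, ?_⟩
    rw [ha]
    rintro j f (hjf | ⟨rfl, rfl⟩)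
    · exact hD j f hjf
    · exact fun _ h => hc (hm.2 h)

/-- The invariant for the main part: the rows are bases. -/
def BasesInv (r : ℕ) (u v : Fin m → Fin n) (s : State) : Prop :=
  Env r u v s ∧ Bits m r (s.arr 1) ∧ ∀ i, IsBase ℚ (edgeVec u v) (rows m r (s.arr 1) i)

lemma BasesInv.setVar (hs : BasesInv r u v s) {x : ℕ} (hx : 5 < x) (k : ℕ) :
    BasesInv r u v (s.setVar x k) :=
  ⟨hs.1.setVar hx k, hs.2⟩

lemma trees_spec (hs : Env r u v s)
    (h1 : ∀ (i : Fin r) (k : Fin m), s.arr 1 (i * m + k) = 1) : BasesInv r u v (trees.den s) := by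
  have h0 : TreesInv u v (fun (i : Fin r) _ => (i : ℕ) < 0) s := by
    refine ⟨hs, fun i k => (h1 i k).le, fun i e => mem_span_image ?_,
      fun i f h => absurd h (by omega)⟩
    simp [mem_rows, h1]
  have := loop_invariant (x := 6) (b := 4) (c := .loop 7 3 delete) (s := s)
    (fun j => TreesInv u v (fun (i : Fin r) _ => (i : ℕ) < j)) (h0.setVar (by omega) _) ?_
  · obtain ⟨h1, h2, h3, h4⟩ := this
    exact ⟨h1, h2, fun i => ⟨fun f => h4 i f (hs.var_r ▸ i.2), h3 i⟩⟩
  intro j s' hj hx hs'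
  rw [hs.var_r] at hj
  have := loop_invariant (x := 7) (b := 3) (c := delete) (s := s')
    (fun l s' => TreesInv u v (fun (i : Fin r) k => (i : ℕ) < j ∨ (i : ℕ) = j ∧ (k : ℕ) < l) s' ∧
      s'.var 6 = j) ⟨(hs'.mono (by omega)).setVar (by omega) _, by simpa using hx⟩ ?_
  · rw [hs'.1.var_m] at this
    exact (this.1.mono fun i k _ => by have := k.2; omega).setVar (by omega) _
  rintro l s'' hl hx ⟨hs'', h6⟩
  rw [hs'.1.var_m] at hl
  refine ⟨((delete_spec hs'' (i := ⟨j, hj⟩) (e := ⟨l, hl⟩) h6 hx).mono fun i k _ => ?_).setVar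
    (by omega) _, ?_⟩
  · simp only [Fin.ext_iff]
    omega
  · rw [State.var_setVar, if_neg (by omega), den_var (by decide), h6]

/-! ### Labels -/

/-- Counts, in array `5`, how many rows contain each edge. -/
def counts : ForProgram :=
  .loop 7 3 (.seq (.store 5 (.var 7) (.const 0))
    (.loop 6 4 (.branch (entry 6 7)
      (.store 5 (.var 7) (.add (.read 5 (.var 7)) (.const 1))) .skip)))

lemma counts_spec (hs : Env r u v s) (e : Fin m) :
    (counts.den s).arr 5 e = cnt (rows m r (s.arr 1)) e := by
  set a := s.arr 1 with ha
  let f : ℕ → ℕ → ℕ := fun j e => ∑ i ∈ Finset.range j, if a (i * m + e) ≠ 0 then 1 else 0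
  have hf : ∀ e : Fin m, f r e = cnt (rows m r a) e := fun e => by
    simp only [f, cnt, Finset.card_filter, Finset.sum_range, mem_rows]
  rw [← hf]
  have := loop_invariant (x := 7) (b := 3) (s := s) (c := .seq (.store 5 (.var 7) (.const 0))
    (.loop 6 4 (.branch (entry 6 7)
      (.store 5 (.var 7) (.add (.read 5 (.var 7)) (.const 1))) .skip)))
    (fun l s' => Env r u v s' ∧ s'.arr 1 = a ∧ ∀ e < l, s'.arr 5 e = f r e)
    ⟨hs.setVar (by omega) _, rfl, by omega⟩ ?_
  · exact this.2.2 e (hs.var_m ▸ e.2)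
  rintro l s' hl hx ⟨hs', ha', h⟩
  rw [hs.var_m] at hl
  rw [den_seq, den_store]
  simp only [Expr.eval, hx]
  have := loop_invariant (x := 6) (b := 4) (s := s'.setArr 5 l 0) (c := .branch (entry 6 7)
      (.store 5 (.var 7) (.add (.read 5 (.var 7)) (.const 1))) .skip)
    (fun j s' => Env r u v s' ∧ s'.arr 1 = a ∧ s'.var 7 = l ∧ s'.arr 5 l = f j l ∧
      ∀ e < l, s'.arr 5 e = f r e)
    ⟨(hs'.setArr (by omega) (by omega) _ _).setVar (by omega) _, by simpa using ha',
      by simpa using hx, by simp [f], fun e he => ?_⟩ ?_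
  · rw [State.var_setArr, hs'.var_r] at this
    obtain ⟨h1, h2, -, h3, h4⟩ := this
    refine ⟨h1.setVar (by omega) _, h2, fun e he => ?_⟩
    rcases Nat.lt_succ_iff_lt_or_eq.1 he with he | rfl
    · exact h4 e he
    · exact h3
  · rw [State.arr_setVar, State.arr_setArr, if_pos rfl, Function.update_of_ne (by omega)]
    exact h e he
  rintro j s'' hj hx' ⟨hs'', ha'', h7, h5, h5'⟩
  rw [State.var_setArr, hs'.var_r] at hj
  rw [den_branch, hs''.eval_entry (i := ⟨j, hj⟩) (e := ⟨l, hl⟩) hx' h7, den_store, den_skip, ha'']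
  have hfs : f (j + 1) l = f j l + if a (j * m + l) ≠ 0 then 1 else 0 := Finset.sum_range_succ _ _
  simp only [Expr.eval, h7, hfs]
  split_ifs with hc
  · refine ⟨(hs''.setArr (by omega) (by omega) _ _).setVar (by omega) _, by simpa using ha'',
      by simpa using h7, by simp [h5], fun e he => ?_⟩
    rw [State.arr_setVar, State.arr_setArr, if_pos rfl, Function.update_of_ne (by omega)]
    exact h5' e he
  · exact ⟨hs''.setVar (by omega) _, ha'', by simpa using h7, h5, h5'⟩

/-- Writes, into array `4`, the label `0` for the edges whose count exceeds that of the edge in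
variable `9` by at least two, and the label `n + m + r + 1`, as "infinity", for all others. -/
def initLabels : ForProgram :=
  .loop 7 3 (.branch (.lt (.add (.read 5 (.var 9)) (.const 1)) (.read 5 (.var 7)))
    (.store 4 (.var 7) (.const 0)) (.store 4 (.var 7) (.var 5)))

lemma initLabels_spec (hs : Env r u v s) {A : ℕ} (hA : s.var 9 = A) (e : Fin m) :
    (initLabels.den s).arr 4 e = if s.arr 5 A + 2 ≤ s.arr 5 e then 0 else n + m + r + 1 := by
  have := loop_invariant (x := 7) (b := 3) (s := s)
    (c := .branch (.lt (.add (.read 5 (.var 9)) (.const 1)) (.read 5 (.var 7)))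
      (.store 4 (.var 7) (.const 0)) (.store 4 (.var 7) (.var 5)))
    (fun l s' => Env r u v s' ∧ s'.var 9 = A ∧ s'.arr 5 = s.arr 5 ∧
      ∀ e < l, s'.arr 4 e = if s.arr 5 A + 2 ≤ s.arr 5 e then 0 else n + m + r + 1)
    ⟨hs.setVar (by omega) _, by simpa using hA, rfl, by omega⟩ ?_
  · exact this.2.2.2 e (hs.var_m ▸ e.2)
  rintro l s' - hx ⟨hs', hA', h5, h⟩
  rw [den_branch, den_store, den_store]
  simp only [Expr.eval, hA', h5, hx, hs'.var_b]
  have hval : ∀ b : ℕ, (b = if s.arr 5 A + 2 ≤ s.arr 5 l then 0 else n + m + r + 1) →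
      Env r u v ((s'.setArr 4 l b).setVar 7 (l + 1)) ∧
      ((s'.setArr 4 l b).setVar 7 (l + 1)).var 9 = A ∧
      ((s'.setArr 4 l b).setVar 7 (l + 1)).arr 5 = s.arr 5 ∧
      ∀ e < l + 1, ((s'.setArr 4 l b).setVar 7 (l + 1)).arr 4 e =
        if s.arr 5 A + 2 ≤ s.arr 5 e then 0 else n + m + r + 1 := fun b hb => by
    refine ⟨(hs'.setArr (by omega) (by omega) _ _).setVar (by omega) _, by simpa using hA',
      by simpa using h5, fun e he => ?_⟩
    rw [State.arr_setVar, State.arr_setArr, if_pos rfl, Function.update_apply]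
    by_cases hel : e = l
    · rw [if_pos hel, hb, hel]
    · rw [if_neg hel]
      exact h e (by omega)
  by_cases h1 : s.arr 5 A + 1 < s.arr 5 l
  · rw [if_pos h1, if_pos one_ne_zero]
    exact hval _ (by rw [if_pos (by omega)])
  · rw [if_neg h1, if_neg (by simp)]
    exact hval _ (by rw [if_neg (by omega)])

/-- Runs `c` if the edge in variable `8` can be exchanged for the edge in variable `7` in row
`var 6`. -/
def ifArc (c : ForProgram) : ForProgram :=
  .branch (entry 6 8) (.branch (entry 6 7) .skip
    (.seq mark (.branch (.read 3 (sndEnd 7)) .skip c))) .skip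

/-- `s'` differs from `s` at most in the memory that is used for marking. -/
def Agree (s s' : State) : Prop :=
  (∀ y, y ≠ 10 → y ≠ 11 → y ≠ 12 → s'.var y = s.var y) ∧ ∀ a ≠ 3, s'.arr a = s.arr a

lemma Agree.refl (s : State) : Agree s s := ⟨fun _ _ _ _ => rfl, fun _ _ => rfl⟩

lemma agree_mark (s : State) : Agree s (mark.den s) :=
  ⟨fun y h1 h2 h3 => den_var (by
      simp only [mark, markStep, ForProgram.vars, List.append_nil, List.nil_append,
        List.mem_cons, List.not_mem_nil, or_false, List.mem_append]
      tauto) s,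
    fun a ha => den_arr (by simp [mark, markStep, ForProgram.arrs, ha]) s⟩

lemma Agree.env {s' : State} (h : Agree s s') (hs : Env r u v s) : Env r u v s' :=
  hs.of_eq (h.1 _ (by omega) (by omega) (by omega)) (h.1 _ (by omega) (by omega) (by omega))
    (h.1 _ (by omega) (by omega) (by omega)) (h.1 _ (by omega) (by omega) (by omega))
    (h.2 _ (by omega)) (h.2 _ (by omega))

/-- The test does not disturb the memory that `c` works on. -/
lemma ifArc_spec (hs : Env r u v s) {i : Fin r} {e f : Fin m} (hi : s.var 6 = i) (he : s.var 7 = e)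
    (hf : s.var 8 = f) (c : ForProgram) : ∃ s', Agree s s' ∧
      (Arc ℚ (edgeVec u v) (rows m r (s.arr 1) i) e f → (ifArc c).den s = c.den s') ∧
      (¬ Arc ℚ (edgeVec u v) (rows m r (s.arr 1) i) e f → (ifArc c).den s = s') := by
  rw [ifArc, den_branch, den_branch, den_seq, den_branch, den_skip, den_skip,
    hs.eval_entry hi he, hs.eval_entry hi hf]
  have hm := agree_mark s
  have hsp := mark_spec hs hi he hf
  simp only [Expr.eval,
    (hm.env hs).eval_sndEnd ((hm.1 7 (by omega) (by omega) (by omega)).trans he)]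
  have he' := @mem_rows m r (s.arr 1) i e
  have hf' := @mem_rows m r (s.arr 1) i f
  by_cases h1 : s.arr 1 (i * m + f) = 0
  · refine ⟨s, .refl s, fun h => absurd h1 (hf'.1 h.1), fun _ => by simp [h1]⟩
  by_cases h2 : s.arr 1 (i * m + e) = 0
  · refine ⟨mark.den s, hm, fun h => ?_, fun h => ?_⟩
    · simp [h1, h2, not_not.1 (mt hsp.1 h.2.2)]
    · have : (mark.den s).arr 3 (v e) ≠ 0 := hsp.2 <| by
        by_contra hc
        exact h ⟨hf'.2 h1, fun h => he'.1 h h2, hc⟩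
      simp [h1, h2, this]
  · refine ⟨s, .refl s, fun h => absurd (he'.2 h2) h.2.1, fun _ => by simp [h1, h2]⟩

/-- One label update. -/
def relaxStep : ForProgram :=
  .branch (.lt (.add (.read 4 (.var 8)) (.const 1)) (.read 4 (.var 7)))
    (ifArc (.store 4 (.var 7) (.add (.read 4 (.var 8)) (.const 1)))) .skip

/-- Updates the labels until they are the distances to the edges with label `0`. -/
def relax : ForProgram :=
  .loop 13 5 (.loop 14 5 (.loop 7 3 (.loop 6 4 (.loop 8 3 relaxStep))))

/-- The invariant for label updates. The label `0` is never given to another edge, and labels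
are justified by an arc. -/
def RelaxInv (u v : Fin m → Fin n) (a : ℕ → ℕ) (r : ℕ) (Z : Fin m → Prop) (s : State) : Prop :=
  Env r u v s ∧ s.arr 1 = a ∧ (∀ g : Fin m, s.arr 4 g = 0 ↔ Z g) ∧
    ∀ g : Fin m, s.arr 4 g < n + m + r + 1 → s.arr 4 g ≠ 0 → ∃ i h,
      Arc ℚ (edgeVec u v) (rows m r a i) g h ∧ s.arr 4 h + 1 ≤ s.arr 4 g

lemma RelaxInv.setVar {a : ℕ → ℕ} {Z : Fin m → Prop} (hs : RelaxInv u v a r Z s) {x : ℕ}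
    (hx : 5 < x) (k : ℕ) : RelaxInv u v a r Z (s.setVar x k) :=
  ⟨hs.1.setVar hx k, hs.2⟩

lemma improves_relaxStep (a : ℕ → ℕ) (Z : Fin m → Prop) (i : Fin r) (e f : Fin m) :
    Improves relaxStep
      (fun s => ((RelaxInv u v a r Z s ∧ s.var 7 = e) ∧ s.var 6 = i) ∧ s.var 8 = f)
      (fun s (g : Fin m) => s.arr 4 g) (fun l => ∑ g, l g)
      (fun l => Arc ℚ (edgeVec u v) (rows m r a i) e f → l e ≤ l f + 1) := by
  rintro s ⟨⟨⟨⟨hs, ha, hZ, hA⟩, he⟩, hi⟩, hf⟩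
  obtain ⟨s', hag, h1, h2⟩ := ifArc_spec hs hi he hf
    (.store 4 (.var 7) (.add (.read 4 (.var 8)) (.const 1)))
  have h4 : s'.arr 4 = s.arr 4 := hag.2 4 (by omega)
  have ha' : s'.arr 1 = a := (hag.2 1 (by omega)).trans ha
  have h6 : s'.var 6 = i := (hag.1 6 (by omega) (by omega) (by omega)).trans hi
  have h7 : s'.var 7 = e := (hag.1 7 (by omega) (by omega) (by omega)).trans he
  have h8 : s'.var 8 = f := (hag.1 8 (by omega) (by omega) (by omega)).trans hf
  have hs' := hag.env hs
  rw [relaxStep, den_branch, den_skip]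
  rw [ha] at h1 h2
  simp only [Expr.eval, he, hf]
  by_cases hlt : s.arr 4 f + 1 < s.arr 4 e
  · rw [if_pos hlt, if_pos one_ne_zero]
    by_cases harc : Arc ℚ (edgeVec u v) (rows m r a i) e f
    · rw [h1 harc, den_store]
      simp only [Expr.eval, h7, h8, h4, State.arr_setArr, if_true]
      refine ⟨⟨⟨⟨⟨hs'.setArr (by omega) (by omega) _ _, ?_, ?_, ?_⟩, h7⟩, h6⟩, h8⟩,
        fun h => absurd (h harc) (by omega), fun _ => ?_⟩
      · simpa using ha'
      · intro g
        simp only [State.arr_setArr, if_true, Function.update_apply, Fin.val_inj, h4]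
        split_ifs with hg
        · rw [← hZ, hg]; exact iff_of_false id (by omega)
        · exact hZ g
      · intro g
        simp only [State.arr_setArr, if_true, Function.update_apply, Fin.val_inj, h4]
        split_ifs with hg
        · subst hg
          refine fun _ _ => ⟨i, f, harc, ?_⟩
          split_ifs with hfg
          · subst hfg; omega
          · exact le_rfl
        · intro hgB hg0
          obtain ⟨j, h, hgh, hle⟩ := hA g hgB hg0
          refine ⟨j, h, hgh, ?_⟩
          split_ifs with he'
          · subst he'; omega
          · exact hle
      · refine Finset.sum_lt_sum (fun g _ => ?_) ⟨e, Finset.mem_univ e, by simpa using hlt⟩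
        simp only [Function.update_apply, Fin.val_inj]
        split_ifs with hg
        · subst hg; omega
        · exact le_rfl
    · rw [h2 harc, h4]
      exact ⟨⟨⟨⟨⟨hs', ha', h4 ▸ hZ, h4 ▸ hA⟩, h7⟩, h6⟩, h8⟩, fun _ => rfl,
        fun h => absurd (fun h' => absurd h' harc) h⟩
  · rw [if_neg hlt, if_neg (by simp)]
    exact ⟨⟨⟨⟨⟨hs, ha, hZ, hA⟩, he⟩, hi⟩, hf⟩, fun _ => rfl, fun h => absurd (fun _ => by omega) h⟩

/-- After the updates, the labels are distances. -/
lemma relax_spec {a : ℕ → ℕ} {Z : Fin m → Prop} (hs : RelaxInv u v a r Z s)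
    (hle : ∀ g : Fin m, s.arr 4 g ≤ n + m + r + 1) :
    RelaxInv u v a r Z (relax.den s) ∧ ∀ (g : Fin m) (i : Fin r) (h : Fin m),
      Arc ℚ (edgeVec u v) (rows m r a i) g h →
        (relax.den s).arr 4 g ≤ (relax.den s).arr 4 h + 1 := by
  have hI := Improves.loop (x := 7) (b := 3)
    (fun s k (hs : RelaxInv u v a r Z s) => hs.setVar (by omega) k)
    (fun _ _ => rfl) (fun s hs => hs.1.var_m) fun e =>
    Improves.loop (x := 6) (b := 4) (N := r)
      (fun s k hs => ⟨hs.1.setVar (by omega) k, by simpa using hs.2⟩)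
      (fun _ _ => rfl) (fun s hs => hs.1.1.var_r) fun i =>
      Improves.loop (x := 8) (b := 3) (N := m)
        (fun s k hs => ⟨⟨hs.1.1.setVar (by omega) k, by simpa using hs.1.2⟩, by simpa using hs.2⟩)
        (fun _ _ => rfl) (fun s hs => hs.1.1.1.var_m) fun f => improves_relaxStep a Z i e f
  have hR := (hI.reaches.loop (x := 14) (b := 5) (fun s k hs => hs.setVar (by omega) k)
    (fun _ _ => rfl) (fun s hs => hs.1.var_b)).loop (x := 13) (b := 5)
    (fun s k hs => hs.setVar (by omega) k) (fun _ _ => rfl) (fun s hs => hs.1.var_b)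
  obtain ⟨h1, -, h2⟩ := hR s hs
  refine ⟨h1, fun g i h => (h2.resolve_right fun h => ?_) g i h⟩
  -- the sum of the labels is less than the number of rounds
  have hsum : ∑ g : Fin m, s.arr 4 g ≤ m * (n + m + r + 1) := by
    simpa using Finset.sum_le_card_nsmul Finset.univ (fun g : Fin m => s.arr 4 g) _
      fun g _ => hle g
  have := (Nat.le_add_left _ _).trans (h.trans hsum)
  nlinarith

/-! ### Augmentation along shortest paths -/

lemma rows_swap (a : ℕ → ℕ) (i : Fin r) (e f : Fin m) :
    rows m r (Function.update (Function.update a (i * m + f) 0) (i * m + e) 1) =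
      swapAt (rows m r a) i e f := by
  rw [rows_update_one, rows_update_zero, Function.update_idem, Function.update_self, swapAt, swap]

/-- One step along a shortest path: if the label drops by one along an arc from the current
edge, in variable `7`, then that arc is used for an exchange. -/
def walkStep : ForProgram :=
  .branch (.eq (.add (.read 4 (.var 8)) (.const 1)) (.read 4 (.var 7)))
    (ifArc (.seq (.store 1 (address 6 8) (.const 0))
      (.seq (.store 1 (address 6 7) (.const 1)) (.assign 7 (.var 8))))) .skip

/-- Walks along a shortest path from the edge in variable `9` to an edge with label `0`. -/
def walk : ForProgram :=
  .seq (.assign 7 (.var 9)) (.loop 13 5 (.loop 6 4 (.loop 8 3 walkStep)))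

/-- The invariant for the walk: compared with the family `T₀` at its start, the multiplicity of
the first edge `A` has gone up by one and that of the current edge has gone down by one. -/
def WalkInv (u v : Fin m → Fin n) (L : ℕ → ℕ) (T₀ : Fin r → Finset (Fin m)) (A : Fin m)
    (s : State) : Prop :=
  BasesInv r u v s ∧ s.arr 4 = L ∧ ∃ x : Fin m, s.var 7 = x ∧
    Labelled ℚ (edgeVec u v) (fun g : Fin m => L g) (rows m r (s.arr 1)) (L x) ∧
    ∀ e, cnt (rows m r (s.arr 1)) e + (if e = x then 1 else 0) =
      cnt T₀ e + (if e = A then 1 else 0)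

lemma WalkInv.setVar {L : ℕ → ℕ} {T₀ : Fin r → Finset (Fin m)} {A : Fin m}
    (hs : WalkInv u v L T₀ A s) {x : ℕ} (hx : 5 < x) (hx7 : x ≠ 7) (k : ℕ) :
    WalkInv u v L T₀ A (s.setVar x k) := by
  obtain ⟨h1, h2, y, h3, h4⟩ := hs
  refine ⟨h1.setVar hx k, h2, y, ?_, h4⟩
  rwa [State.var_setVar, if_neg (by omega)]

lemma improves_walkStep (L : ℕ → ℕ) (T₀ : Fin r → Finset (Fin m)) (A : Fin m) (i : Fin r)
    (f : Fin m) :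
    Improves walkStep (fun s => (WalkInv u v L T₀ A s ∧ s.var 6 = i) ∧ s.var 8 = f)
      (fun s => (rows m r (s.arr 1), s.var 7)) (fun p => L p.2)
      (fun p => ∀ x : Fin m, p.2 = x →
        ¬ (L f + 1 = L x ∧ Arc ℚ (edgeVec u v) (p.1 i) x f)) := by
  rintro s ⟨⟨⟨⟨hs, hb, hT⟩, hL, x, hx, hl, hc⟩, hi⟩, hf⟩
  obtain ⟨s', hag, h1, h2⟩ := ifArc_spec hs hi hx hf
    (.seq (.store 1 (address 6 8) (.const 0))
      (.seq (.store 1 (address 6 7) (.const 1)) (.assign 7 (.var 8))))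
  have h4 : s'.arr 4 = L := (hag.2 4 (by omega)).trans hL
  have ha' : s'.arr 1 = s.arr 1 := hag.2 1 (by omega)
  have h6 : s'.var 6 = i := (hag.1 6 (by omega) (by omega) (by omega)).trans hi
  have h7 : s'.var 7 = x := (hag.1 7 (by omega) (by omega) (by omega)).trans hx
  have h8 : s'.var 8 = f := (hag.1 8 (by omega) (by omega) (by omega)).trans hf
  have hs' := hag.env hs
  rw [walkStep, den_branch, den_skip]
  simp only [Expr.eval, hx, hf, hL]
  by_cases heq : L f + 1 = L x
  · rw [if_pos heq, if_pos one_ne_zero]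
    by_cases harc : Arc ℚ (edgeVec u v) (rows m r (s.arr 1) i) x f
    · set s₁ := s'.setArr 1 (i * m + f) 0 with hs₁
      have he₁ : Env r u v s₁ := hs'.setArr (by omega) (by omega) _ _
      rw [h1 harc, den_seq, den_store, hs'.eval_address h6 h8, Expr.eval, ← hs₁, den_seq, den_store,
        he₁.eval_address (i := i) (e := x) h6 h7, den_assign]
      simp only [Expr.eval]
      set s₂ := (s₁.setArr 1 (i * m + x) 1).setVar 7 ((s₁.setArr 1 (i * m + x) 1).var 8) with hs₂
      have he₂ : Env r u v s₂ := (he₁.setArr (by omega) (by omega) _ _).setVar (by omega) _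
      have harr : s₂.arr 1 = Function.update (Function.update (s.arr 1) (i * m + f) 0)
          (i * m + x) 1 := by
        simp [hs₂, hs₁, ha']
      have hrows : rows m r (s₂.arr 1) = swapAt (rows m r (s.arr 1)) i x f := by
        rw [harr, rows_swap]
      have h7' : s₂.var 7 = f := by simp [hs₂, hs₁, h8]
      refine ⟨⟨⟨⟨⟨he₂, ?_, ?_⟩, ?_, f, h7', ?_, ?_⟩, ?_⟩, ?_⟩, fun h => ?_, fun _ => ?_⟩
      · rw [harr]
        exact (hb.update _ (by omega)).update _ le_rfl
      · rw [hrows]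
        exact IsBase.swapAt hT harc
      · simpa [hs₂, hs₁] using h4
      · rw [hrows]
        exact Labelled.swapAt (l := fun g : Fin m => L g) hl harc heq
      · intro e
        rw [hrows, cnt_swapAt harc.1 harc.2.1]
        exact hc e
      · simpa [hs₂, hs₁] using h6
      · simpa [hs₂, hs₁] using h8
      · exact absurd ⟨heq, harc⟩ (h x rfl)
      · rw [h7']; omega
    · rw [h2 harc, ha']
      refine ⟨⟨⟨⟨⟨hs', ha' ▸ hb, ha' ▸ hT⟩, h4, x, h7, ha' ▸ hl, ha' ▸ hc⟩, h6⟩, h8⟩, fun _ => ?_,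
        fun h => absurd (fun y hy hxy => harc ?_) h⟩
      · rw [h7]
      · rw [Fin.ext hy]; exact hxy.2
  · rw [if_neg heq, if_neg (by simp)]
    refine ⟨⟨⟨⟨⟨hs, hb, hT⟩, hL, x, hx, hl, hc⟩, hi⟩, hf⟩, fun _ => by rw [hx],
      fun h => absurd (fun y hy hxy => heq ?_) h⟩
    rw [Fin.ext hy]; exact hxy.1

/-- The walk reaches an edge with label `0`. -/
lemma walk_spec {A : Fin m} (hs : BasesInv r u v s) (hA : s.var 9 = A)
    (hlt : s.arr 4 A < n + m + r + 1)
    (hl : Labelled ℚ (edgeVec u v) (fun g : Fin m => s.arr 4 g) (rows m r (s.arr 1)) (s.arr 4 A)) :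
    BasesInv r u v (walk.den s) ∧ ∃ x : Fin m, s.arr 4 x = 0 ∧
      ∀ e, cnt (rows m r ((walk.den s).arr 1)) e + (if e = x then 1 else 0) =
        cnt (rows m r (s.arr 1)) e + (if e = A then 1 else 0) := by
  have hR := ((Improves.loop (x := 6) (b := 4)
    (fun s' k (hs' : WalkInv u v (s.arr 4) (rows m r (s.arr 1)) A s') =>
      hs'.setVar (by omega) (by omega) k) (fun _ _ => rfl) (fun s' hs' => hs'.1.1.var_r) fun i =>
    Improves.loop (x := 8) (b := 3) (N := m)
      (fun s k hs => ⟨hs.1.setVar (by omega) (by omega) k, by simpa using hs.2⟩)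
      (fun _ _ => rfl) (fun s hs => hs.1.1.1.var_m) fun f =>
        improves_walkStep (s.arr 4) (rows m r (s.arr 1)) A i f).reaches).loop
    (x := 13) (b := 5) (fun s k hs => hs.setVar (by omega) (by omega) k)
    (fun _ _ => rfl) (fun s hs => hs.1.1.var_b)
  have hden : walk.den s = (ForProgram.loop 13 5 (.loop 6 4 (.loop 8 3 walkStep))).den
      (s.setVar 7 A) := by
    rw [walk, den_seq, den_assign, Expr.eval, hA]
  obtain ⟨⟨h1, hL, x, hx, hl', hc⟩, -, h2⟩ := hR (s.setVar 7 A)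
    ⟨hs.setVar (by omega) _, rfl, A, by simp, hl, fun _ => rfl⟩
  rw [← hden] at *
  have h2' := h2.resolve_right fun h => by
    simp only [State.var_setVar, if_true] at h
    omega
  refine ⟨h1, x, ?_, hc⟩
  by_contra hx0
  obtain ⟨i, f, harc, hf⟩ := hl'.exists_arc x le_rfl hx0
  exact h2' i f x hx ⟨hf, harc⟩

/-- Raises the multiplicity of the edge in variable `9` at the expense of an edge whose multiplicity
is greater by at least two, if possible. -/
def augment : ForProgram :=
  .seq counts (.seq initLabels (.seq relax (.branch (.lt (.read 4 (.var 9)) (.var 5)) walk .skip)))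

/-- The objective goes down unless the edge gets no label, that is, unless it is blocked. -/
lemma improves_augment (A : Fin m) :
    Improves augment (fun s => BasesInv r u v s ∧ s.var 9 = A) (fun s => rows m r (s.arr 1)) overlap
      (fun T => Blocked ℚ (edgeVec u v) T A) := by
  rintro s ⟨⟨hs, hb, hT⟩, hA⟩
  set T := rows m r (s.arr 1) with hTdef
  rw [augment, den_seq, den_seq, den_seq, den_branch, den_skip]
  set s₁ := counts.den s with h₁
  have hc : ∀ e : Fin m, s₁.arr 5 e = cnt T e := counts_spec hs
  have hA₁ : s₁.var 9 = A := (den_var (by decide) s).trans hA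
  have hs₁ : Env r u v s₁ := hs.den _
  have ha₁ : s₁.arr 1 = s.arr 1 := den_arr (by decide) s
  set s₂ := initLabels.den s₁ with h₂
  have hl : ∀ e : Fin m, s₂.arr 4 e = if cnt T A + 2 ≤ cnt T e then 0 else n + m + r + 1 :=
    fun e => by rw [← hc, ← hc]; exact initLabels_spec hs₁ hA₁ e
  have hA₂ : s₂.var 9 = A := (den_var (by decide) s₁).trans hA₁
  have hs₂ : Env r u v s₂ := hs₁.den _
  have ha₂ : s₂.arr 1 = s.arr 1 := (den_arr (by decide) s₁).trans ha₁
  have hinv : RelaxInv u v (s.arr 1) r (fun g => cnt T A + 2 ≤ cnt T g) s₂ := by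
    refine ⟨hs₂, ha₂, fun g => ?_, fun g => ?_⟩
    · rw [hl]
      split_ifs with h <;> simp [h]
    · rw [hl]
      split_ifs with h
      · exact fun _ h => absurd rfl h
      · exact fun h => absurd h (lt_irrefl _)
  obtain ⟨⟨hs₃, ha₃, hZ, hE⟩, hle⟩ := relax_spec hinv fun g => by
    rw [hl]
    split_ifs <;> omega
  have hA₃ : (relax.den s₂).var 9 = A := (den_var (by decide) s₂).trans hA₂
  set s₃ := relax.den s₂ with h₃
  rw [← hTdef] at hle hE
  have hB₃ : BasesInv r u v s₃ := ⟨hs₃, ha₃ ▸ hb, by rw [ha₃]; exact hT⟩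
  have hE' : ∀ g : Fin m, s₃.arr 4 g < n + m + r + 1 → s₃.arr 4 g ≠ 0 →
      ∃ i h, Arc ℚ (edgeVec u v) (T i) g h ∧ s₃.arr 4 h + 1 = s₃.arr 4 g := fun g h1 h2 => by
    obtain ⟨i, h, hgh, hh⟩ := hE g h1 h2
    exact ⟨i, h, hgh, le_antisymm hh (hle g i h hgh)⟩
  have hblock : n + m + r + 1 ≤ s₃.arr 4 A → Blocked ℚ (edgeVec u v) T A := fun h =>
    blocked_of_label_eq (l := fun g : Fin m => s₃.arr 4 g) (B := n + m + r + 1)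
      (by rw [Fintype.card_fin]; omega) (fun g => (hZ g).2) hle hE' h
  have hblock' : Blocked ℚ (edgeVec u v) T A → n + m + r + 1 ≤ s₃.arr 4 A := fun h =>
    label_ge_of_blocked (l := fun g : Fin m => s₃.arr 4 g) h (fun g => (hZ g).1) hE'
  simp only [Expr.eval, hA₃, hs₃.var_b]
  by_cases hlt : s₃.arr 4 A < n + m + r + 1
  · rw [if_pos hlt, if_pos one_ne_zero]
    obtain ⟨h1, x, hx, hcx⟩ := walk_spec hB₃ hA₃ hlt
      ⟨fun g i h _ hgh => hle g i h (by rwa [ha₃] at hgh), fun g hg hg0 => by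
        rw [ha₃]
        exact hE' g (hg.trans_lt hlt) hg0⟩
    rw [ha₃] at hcx
    refine ⟨⟨h1, (den_var (by decide) s₃).trans hA₃⟩, fun h => absurd (hblock' h) (by omega),
      fun _ => overlap_lt ((hZ x).1 hx) hcx⟩
  · rw [if_neg hlt, if_neg (by simp)]
    exact ⟨⟨hB₃, hA₃⟩, fun _ => by rw [ha₃], fun h => absurd (hblock (by omega)) h⟩

/-- Augments as long as possible. -/
def improve : ForProgram := .loop 15 5 (.loop 16 5 (.loop 17 5 (.loop 9 3 augment)))

lemma overlap_le (T : Fin r → Finset (Fin m)) : overlap T ≤ m * r ^ 2 := by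
  have := Finset.sum_le_card_nsmul Finset.univ (fun e : Fin m => cnt T e ^ 2) (r ^ 2) fun e _ =>
    Nat.pow_le_pow_left (by simpa using cnt_le_card T e) 2
  simpa [overlap] using this

lemma improve_spec (hs : BasesInv r u v s) : BasesInv r u v (improve.den s) ∧
    ∀ A, Blocked ℚ (edgeVec u v) (rows m r ((improve.den s).arr 1)) A := by
  have hR := ((((Improves.loop (x := 9) (b := 3)
    (fun s k (hs : BasesInv r u v s) => hs.setVar (by omega) k) (fun _ _ => rfl)
    (fun s hs => hs.1.var_m) fun A => improves_augment A).reaches).loop (x := 17) (b := 5)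
    (fun s k hs => hs.setVar (by omega) k) (fun _ _ => rfl) (fun s hs => hs.1.var_b)).loop (x := 16)
    (b := 5) (fun s k hs => hs.setVar (by omega) k) (fun _ _ => rfl) (fun s hs => hs.1.var_b)).loop
    (x := 15) (b := 5) (fun s k hs => hs.setVar (by omega) k) (fun _ _ => rfl)
    (fun s hs => hs.1.var_b)
  obtain ⟨h1, -, h2⟩ := hR s hs
  refine ⟨h1, h2.resolve_right fun h => ?_⟩
  have h3 := (Nat.le_add_left _ _).trans (h.trans (overlap_le _))
  set B := n + m + r + 1
  -- the initial value of the objective is less than the number of rounds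
  have h4 : m * r ^ 2 < B * (B * (B * 1)) := by
    have h5 : m * r ^ 2 ≤ m * (B * (B * 1)) := by
      rw [mul_one, sq]
      exact Nat.mul_le_mul_left _ (Nat.mul_le_mul (by omega) (by omega))
    exact h5.trans_lt (Nat.mul_lt_mul_of_pos_right (by omega) (by positivity))
  omega

/-! ### Spanning trees as bases -/

variable {G : SimpleGraph (Fin n)}

/-- The pairs `u k, v k` are the edges of `G`, without repetition. -/
def Enumerates (G : SimpleGraph (Fin n)) (u v : Fin m → Fin n) : Prop :=
  Function.Injective (fun k => s(u k, v k)) ∧ ∀ z, z ∈ G.edgeSet ↔ ∃ k, s(u k, v k) = z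

/-- The graph with the edges `u k, v k` for `k` in `S`. -/
def graphOf (u v : Fin m → Fin n) (S : Finset (Fin m)) : SimpleGraph (Fin n) :=
  .fromEdgeSet ((fun k => s(u k, v k)) '' S)

open Classical in
/-- The indices of the edges of `T`. -/
noncomputable def indices (u v : Fin m → Fin n) (T : SimpleGraph (Fin n)) : Finset (Fin m) :=
  Finset.univ.filter fun k => T.Adj (u k) (v k)

lemma mem_indices {T : SimpleGraph (Fin n)} {k : Fin m} :
    k ∈ indices u v T ↔ T.Adj (u k) (v k) := by
  simp [indices]

lemma eq_of_reachable {α : Type*} {H : SimpleGraph (Fin n)} {χ : Fin n → α}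
    (h : ∀ a b, H.Adj a b → χ a = χ b) {a b : Fin n} (hab : H.Reachable a b) : χ a = χ b := by
  obtain ⟨p⟩ := hab
  induction p with
  | nil => rfl
  | cons hadj _ ih => exact (h _ _ hadj).trans ih

lemma Enumerates.adj (h : Enumerates G u v) (k : Fin m) : G.Adj (u k) (v k) :=
  (h.2 _).2 ⟨k, rfl⟩

lemma Enumerates.exists_of_adj (h : Enumerates G u v) {a b : Fin n} (hab : G.Adj a b) :
    ∃ k, s(u k, v k) = s(a, b) := (h.2 s(a, b)).1 hab

lemma eq_of_sym2_eq {α : Type*} {χ : Fin n → α} {a b c d : Fin n} (h : s(a, b) = s(c, d))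
    (hχ : χ a = χ b) : χ c = χ d := by
  rcases Sym2.eq_iff.1 h with ⟨rfl, rfl⟩ | ⟨rfl, rfl⟩
  · exact hχ
  · exact hχ.symm

lemma adj_of_sym2_eq {T : SimpleGraph (Fin n)} {a b c d : Fin n} (h : s(a, b) = s(c, d))
    (hT : T.Adj a b) : T.Adj c d := by
  rw [← SimpleGraph.mem_edgeSet, ← h]
  exact hT

lemma Enumerates.adj_graphOf (h : Enumerates G u v) {S : Finset (Fin m)} {k : Fin m} :
    (graphOf u v S).Adj (u k) (v k) ↔ k ∈ S := by
  rw [graphOf, SimpleGraph.fromEdgeSet_adj]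
  constructor
  · rintro ⟨⟨j, hj, hjk⟩, -⟩
    rwa [← h.1 hjk]
  · exact fun hk => ⟨⟨k, hk, rfl⟩, (h.adj k).ne⟩

lemma exists_of_adj_graphOf {S : Finset (Fin m)} {a b : Fin n} (hab : (graphOf u v S).Adj a b) :
    ∃ k ∈ S, s(u k, v k) = s(a, b) := by
  rw [graphOf, SimpleGraph.fromEdgeSet_adj] at hab
  exact hab.1

lemma Enumerates.edgeSet_eq (h : Enumerates G u v) {T : SimpleGraph (Fin n)} (hT : T ≤ G) :
    T.edgeSet = (fun k => s(u k, v k)) '' (indices u v T) := by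
  ext z
  constructor
  · intro hz
    obtain ⟨k, rfl⟩ := (h.2 z).1 (SimpleGraph.edgeSet_mono hT hz)
    exact ⟨k, mem_indices.2 hz, rfl⟩
  · rintro ⟨k, hk, rfl⟩
    exact mem_indices.1 hk

lemma Enumerates.indices_graphOf (h : Enumerates G u v) (S : Finset (Fin m)) :
    indices u v (graphOf u v S) = S := by
  ext k
  rw [mem_indices, h.adj_graphOf]

/-- The edges of a spanning tree form a basis: an edge `f` is not spanned by the others as the
vertices that are reachable from one end of `f` without using `f` are a potential that separates
it from them. -/
lemma Enumerates.isBase (h : Enumerates G u v) {T : SimpleGraph (Fin n)}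
    (hT : IsSpanningTree G T) : IsBase ℚ (edgeVec u v) (indices u v T) := by
  classical
  obtain ⟨hle, hT⟩ := hT
  constructor
  · intro f hf hc
    have hbr := SimpleGraph.isBridge_iff.1
      (SimpleGraph.isAcyclic_iff_forall_adj_isBridge.1 hT.isAcyclic (mem_indices.1 hf))
    set H := T.deleteEdges {s(u f, v f)} with hH
    have := edgeVec_mem_span_iff.1 hc (fun w => if H.Reachable (u f) w then 1 else 0)
      fun g hg => by
        obtain ⟨hgf, hgT⟩ := Finset.mem_erase.1 hg
        have hadj : H.Adj (u g) (v g) := by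
          rw [hH, SimpleGraph.deleteEdges_adj]
          exact ⟨mem_indices.1 hgT, fun hc => hgf (h.1 hc)⟩
        have : H.Reachable (u f) (u g) ↔ H.Reachable (u f) (v g) :=
          ⟨fun hr => hr.trans hadj.reachable, fun hr => hr.trans hadj.symm.reachable⟩
        simp only [this]
    simp only [SimpleGraph.Reachable.refl, if_true, hbr, if_false] at this
    exact one_ne_zero this
  · intro e
    rw [edgeVec_mem_span_iff]
    intro χ hχ
    refine eq_of_reachable (fun a b hab => ?_) (hT.connected.preconnected (u e) (v e))
    obtain ⟨k, hk⟩ := h.exists_of_adj (hle hab)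
    exact eq_of_sym2_eq hk (hχ k (mem_indices.2 (adj_of_sym2_eq hk.symm hab)))

/-- Conversely, a basis is the edge set of a spanning tree if the graph is connected. -/
lemma Enumerates.isSpanningTree (h : Enumerates G u v) (hG : G.Connected) {S : Finset (Fin m)}
    (hS : IsBase ℚ (edgeVec u v) S) : IsSpanningTree G (graphOf u v S) := by
  classical
  refine ⟨fun a b hab => ?_, ?_, ?_⟩
  · obtain ⟨k, -, hk⟩ := exists_of_adj_graphOf hab
    exact adj_of_sym2_eq hk (h.adj k)
  · refine (SimpleGraph.connected_iff _).2 ⟨fun a b => ?_, hG.nonempty⟩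
    set H := graphOf u v S with hH
    -- the vertices reachable from `a` are a potential that is constant along the edges in `S`
    have key : ∀ k, (if H.Reachable a (u k) then (1 : ℚ) else 0) =
        if H.Reachable a (v k) then 1 else 0 := fun k =>
      edgeVec_mem_span_iff.1 (hS.2 k) (fun w => if H.Reachable a w then 1 else 0) fun g hg => by
        have hadj : H.Adj (u g) (v g) := h.adj_graphOf.2 hg
        have : H.Reachable a (u g) ↔ H.Reachable a (v g) :=
          ⟨fun hr => hr.trans hadj.reachable, fun hr => hr.trans hadj.symm.reachable⟩
        simp only [this]
    have := eq_of_reachable (χ := fun w => if H.Reachable a w then (1 : ℚ) else 0)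
      (fun c d hcd => by
      obtain ⟨k, hk⟩ := h.exists_of_adj hcd
      exact eq_of_sym2_eq (χ := fun w => if H.Reachable a w then (1 : ℚ) else 0) hk (key k))
      (hG.preconnected a b)
    simp only [SimpleGraph.Reachable.refl, if_true] at this
    by_contra hc
    rw [if_neg hc] at this
    exact one_ne_zero this
  · rw [SimpleGraph.isAcyclic_iff_forall_adj_isBridge]
    intro a b hab
    obtain ⟨k, hk, hkab⟩ := exists_of_adj_graphOf hab
    rw [SimpleGraph.isBridge_iff]
    intro hr
    apply hS.1 k hk
    rw [edgeVec_mem_span_iff]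
    intro χ hχ
    refine eq_of_sym2_eq hkab.symm (eq_of_reachable (fun c d hcd => ?_) hr)
    rw [SimpleGraph.deleteEdges_adj] at hcd
    obtain ⟨j, hj, hjcd⟩ := exists_of_adj_graphOf hcd.1
    refine eq_of_sym2_eq hjcd (hχ j (Finset.mem_erase.2 ⟨?_, hj⟩))
    rintro rfl
    exact hcd.2 (hjcd.symm.trans hkab)

/-- An edge that is in `c` of `r` sets contributes `c (r - c)` to the sum of their distances. -/
lemma Enumerates.dSum_add_overlap (h : Enumerates G u v) {T : Fin r → SimpleGraph (Fin n)}
    (hT : ∀ i, T i ≤ G) : dSum (fun i => (T i).edgeSet) + overlap (fun i => indices u v (T i)) =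
      r * ∑ e, cnt (fun i => indices u v (T i)) e := by
  set S := fun i => indices u v (T i) with hSdef
  have hdiff : ∀ i j, ((T i).edgeSet \ (T j).edgeSet).ncard = (S i \ S j).card := fun i j => by
    rw [h.edgeSet_eq (hT i), h.edgeSet_eq (hT j), ← Set.image_sdiff h.1,
      Set.ncard_image_of_injective _ h.1, ← Finset.coe_sdiff, Set.ncard_coe_finset]
  have h1 : dSum (fun i => (T i).edgeSet) = ∑ i, ∑ j, (S i \ S j).card := by
    simp only [dSum, hdiff]
    have hsplit : ∀ i j : Fin r, (if i < j then (S i \ S j).card + (S j \ S i).card else 0) =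
        (if i < j then (S i \ S j).card else 0) + if i < j then (S j \ S i).card else 0 :=
      fun i j => by split_ifs <;> rfl
    simp only [hsplit, Finset.sum_add_distrib]
    rw [Finset.sum_comm (f := fun i j : Fin r => if i < j then (S j \ S i).card else 0)]
    simp only [← Finset.sum_add_distrib]
    refine Finset.sum_congr rfl fun i _ => Finset.sum_congr rfl fun j _ => ?_
    rcases lt_trichotomy i j with hij | rfl | hij
    · simp [hij, hij.not_gt]
    · simp
    · simp [hij, hij.not_gt]
  have h2 : overlap S = ∑ i, ∑ j, (S i ∩ S j).card := by
    have : ∀ e, cnt S e ^ 2 = ∑ i, if e ∈ S i then cnt S e else 0 := fun e => by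
      rw [← Finset.sum_filter, Finset.sum_const, smul_eq_mul, sq]
      rfl
    simp only [overlap, this]
    rw [Finset.sum_comm]
    refine Finset.sum_congr rfl fun i _ => ?_
    rw [← Finset.sum_filter, Finset.filter_mem_eq_inter, Finset.univ_inter, sum_cnt]
    exact Finset.sum_congr rfl fun j _ => by rw [Finset.inter_comm]
  rw [h1, h2, ← Finset.sum_add_distrib, sum_cnt, Finset.mul_sum]
  refine Finset.sum_congr rfl fun i _ => ?_
  rw [← Finset.sum_add_distrib, Finset.inter_univ]
  simp only [Finset.card_sdiff_add_card_inter, Finset.sum_const, Finset.card_univ,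
    Fintype.card_fin, smul_eq_mul]

/-- Spanning trees with minimal overlap are most diverse, as the sum of the multiplicities is the
same for all families of spanning trees. -/
theorem Enumerates.isMostDiverse (h : Enumerates G u v) (hG : G.Connected)
    {S : Fin r → Finset (Fin m)} (hS : ∀ i, IsBase ℚ (edgeVec u v) (S i))
    (hb : ∀ a, Blocked ℚ (edgeVec u v) S a) : IsMostDiverse G (fun i => graphOf u v (S i)) := by
  have hT := fun i => h.isSpanningTree hG (hS i)
  refine ⟨hT, fun T' hT' => ?_⟩
  have hS' := fun i => h.isBase (hT' i)
  have h1 : dSum (fun i => (graphOf u v (S i)).edgeSet) + overlap S = r * ∑ e, cnt S e := by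
    simpa only [h.indices_graphOf] using h.dSum_add_overlap fun i => (hT i).1
  have h2 := h.dSum_add_overlap fun i => (hT' i).1
  have h3 := overlap_le_of_blocked hS hS' hb
  rw [sum_cnt_eq hS hS'] at h2
  change _ ≤ dSum fun i => (graphOf u v (S i)).edgeSet
  omega

/-! ### The whole program -/

/-- Reads `n`, `m` and `r` from the input. -/
def readParameters : ForProgram :=
  .seq (.assign 2 (.read 0 (.const 0))) (.seq (.assign 3 (.read 0 (.const 1)))
    (.seq (.assign 4 (.read 0 (.const 2)))
      (.assign 5 (.add (.add (.add (.var 2) (.var 3)) (.var 4)) (.const 1)))))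

/-- Computes the offsets of the characteristic vectors and the length of the output. -/
def offsets : ForProgram :=
  .seq (.assign 1 (.const 0))
    (.loop 6 4 (.seq (.store 2 (.var 6) (.var 1)) (.assign 1 (.add (.var 1) (.var 3)))))

/-- The program after the parameters have been read. -/
def main : ForProgram := .seq offsets (.seq fill (.seq trees improve))

lemma offsets_spec (h3 : s.var 3 = m) (h4 : s.var 4 = r) :
    (offsets.den s).var 1 = r * m ∧ ∀ i < r, (offsets.den s).arr 2 i = i * m := by
  rw [offsets, den_seq, den_assign]
  simp only [Expr.eval]
  have := loop_invariant (x := 6) (b := 4) (s := s.setVar 1 0)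
    (c := .seq (.store 2 (.var 6) (.var 1)) (.assign 1 (.add (.var 1) (.var 3))))
    (fun j s' => s'.var 3 = m ∧ s'.var 1 = j * m ∧ ∀ i < j, s'.arr 2 i = i * m)
    ⟨by simpa using h3, by simp, by omega⟩ ?_
  · simp only [State.var_setVar, h4] at this
    exact this.2
  rintro j s' - hx ⟨h3', h1, h2⟩
  rw [den_seq, den_store, den_assign]
  refine ⟨by simpa using h3', by simp [Expr.eval, h1, h3', add_mul], fun i hi => ?_⟩
  simp only [Expr.eval, State.arr_setVar, State.arr_setArr, if_true, hx, h1, Function.update_apply]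
  split_ifs with hij
  · rw [hij]
  · exact h2 i (by omega)

lemma getD_flatMap_pair {es : List (Fin n × Fin n)} {k : ℕ} (hk : k < es.length) :
    (es.flatMap fun p => [(p.1 : ℕ), (p.2 : ℕ)]).getD (k + k) 0 = es[k].1 ∧
      (es.flatMap fun p => [(p.1 : ℕ), (p.2 : ℕ)]).getD (1 + (k + k)) 0 = es[k].2 := by
  induction es generalizing k with
  | nil => simp at hk
  | cons p es ih =>
    cases k with
    | zero => simp
    | succ k =>
      have := ih (k := k) (by simpa using hk)
      rw [show k + 1 + (k + 1) = k + k + 2 by omega,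
        show 1 + (k + k + 2) = 1 + (k + k) + 2 by omega]
      simpa using this

lemma readParameters_spec (r : ℕ) (es : List (Fin n × Fin n)) :
    let s := readParameters.den (State.init (encodeInstance n r es))
    s.var 2 = n ∧ s.var 3 = es.length ∧ s.var 4 = r ∧ s.var 5 = n + es.length + r + 1 ∧
      s.arr 0 = fun i => (encodeInstance n r es).getD i 0 := by
  simp [readParameters, den, Expr.eval, State.init, encodeInstance]

lemma main_spec (r : ℕ) (es : List (Fin n × Fin n)) :
    let s := main.den (readParameters.den (State.init (encodeInstance n r es)))
    BasesInv r (fun k => (es.get k).1) (fun k => (es.get k).2) s ∧ s.var 1 = r * es.length ∧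
      ∀ A, Blocked ℚ (edgeVec (fun k => (es.get k).1) (fun k => (es.get k).2))
        (rows es.length r (s.arr 1)) A := by
  obtain ⟨h2, h3, h4, h5, h0⟩ := readParameters_spec r es
  set s := readParameters.den (State.init (encodeInstance n r es))
  obtain ⟨o1, o2⟩ := offsets_spec h3 h4
  have harr : (offsets.den s).arr 0 = fun i => (encodeInstance n r es).getD i 0 :=
    (den_arr (by decide) s).trans h0
  have hs : Env r (fun k => (es.get k).1) (fun k => (es.get k).2) (offsets.den s) := by
    refine ⟨(den_var (by decide) s).trans h2, (den_var (by decide) s).trans h3,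
      (den_var (by decide) s).trans h4, (den_var (by decide) s).trans h5, fun k => ?_, fun k => ?_,
      fun i => o2 i i.2⟩
    · rw [harr, show 3 + ((k : ℕ) + k) = k + k + 3 by omega]
      simpa [encodeInstance] using (getD_flatMap_pair k.2).1
    · rw [harr, show 4 + ((k : ℕ) + k) = 1 + (k + k) + 3 by omega]
      simpa [encodeInstance] using (getD_flatMap_pair k.2).2
  obtain ⟨g1, g2⟩ := improve_spec (trees_spec (hs.den fill) (fill_spec hs))
  refine ⟨g1, ?_, g2⟩
  rw [main, den_seq, den_seq, den_seq, den_var (by decide), den_var (by decide),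
    den_var (by decide), o1]

/-- A list of length `r * m`, cut into `r` blocks of length `m`. -/
lemma map_range_mul {α : Type*} (f : ℕ → α) (r m : ℕ) : (List.range (r * m)).map f =
    (List.finRange r).flatMap fun i : Fin r => (List.finRange m).map fun k : Fin m =>
      f (i * m + k) := by
  have hfin : ∀ (k : ℕ) (g : ℕ → α), (List.finRange k).map (fun i : Fin k => g i) =
      (List.range k).map g := fun k g => by
    rw [← List.map_coe_finRange_eq_range, List.map_map]; rfl
  have hfm : ∀ (k : ℕ) (g : ℕ → List α), (List.finRange k).flatMap (fun i : Fin k => g i) =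
      (List.range k).flatMap g := fun k g => by
    rw [← List.map_coe_finRange_eq_range, List.flatMap_map]
  rw [hfm r (fun i => (List.finRange m).map fun k : Fin m => f (i * m + k))]
  induction r with
  | zero => simp
  | succ r ih =>
    rw [add_mul, one_mul, List.range_add, List.map_append, ih, List.range_succ,
      List.flatMap_append, List.map_map]
    congr 1
    simp only [List.flatMap_cons, List.flatMap_nil, List.append_nil]
    rw [hfin m fun k => f (r * m + k)]
    rfl

end DiverseTrees

open DiverseTrees RAM ForProgram in
theorem mainTheorem1 :
    ∃ (c : RAM.Program) (P : Polynomial ℕ),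
      ∀ (n r : ℕ) (G : SimpleGraph (Fin n)) (es : List (Fin n × Fin n)), IsEdgeList G es →
        ∃ out : List ℕ,
          c.OutputsWithin (encodeInstance n r es) out (P.eval (n + es.length + r)) ∧
          (G.Connected →
            ∃ T : Fin r → SimpleGraph (Fin n), IsMostDiverse G T ∧ out = encodeTrees es T) := by
  refine ⟨.seq readParameters.compile main.compile,
    readParameters.cost + main.cost.comp (.X + 1), fun n r G es hes => ?_⟩
  obtain ⟨h2, h3, h4, h5, -⟩ := readParameters_spec r es
  obtain ⟨⟨-, hb, hT⟩, h1, hbl⟩ := main_spec r es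
  set s₁ := readParameters.den (State.init (encodeInstance n r es)) with hs₁
  set s₂ := main.den s₁
  obtain ⟨t₁, ht₁, e₁⟩ := exec_compile (c := readParameters) (by decide) (by decide)
    (B := n + es.length + r) (State.init (encodeInstance n r es)) (by simp [readParameters, bounds])
  obtain ⟨t₂, ht₂, e₂⟩ := exec_compile (c := main) (by decide) (by decide)
    (B := n + es.length + r + 1) s₁ (by
      have hbd : ∀ b ∈ main.bounds, b = 2 ∨ b = 3 ∨ b = 4 ∨ b = 5 := by decide
      intro b hb
      rcases hbd b hb with rfl | rfl | rfl | rfl <;> omega)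
  refine ⟨_, ⟨t₁ + t₂, s₂, .seq e₁ e₂, ?_, rfl⟩, fun hG => ?_⟩
  · simp only [Polynomial.eval_add, Polynomial.eval_comp, Polynomial.eval_X, Polynomial.eval_one]
    omega
  have hE : Enumerates G (fun k : Fin es.length => (es.get k).1) (fun k => (es.get k).2) := by
    obtain ⟨hnd, hmem⟩ := hes
    constructor
    · intro j k hjk
      have := List.nodup_iff_injective_get.1 hnd
      have h := @this ⟨j, by simp⟩ ⟨k, by simp⟩ (by simpa using hjk)
      exact Fin.ext (by simpa using h)
    · intro z
      rw [← hmem, List.mem_map]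
      constructor
      · rintro ⟨p, hp, rfl⟩
        obtain ⟨k, rfl⟩ := List.get_of_mem hp
        exact ⟨k, rfl⟩
      · rintro ⟨k, rfl⟩
        exact ⟨es.get k, es.get_mem k, rfl⟩
  refine ⟨_, hE.isMostDiverse hG hT hbl, ?_⟩
  rw [State.output, h1, map_range_mul, encodeTrees]
  refine List.flatMap_congr fun i _ => ?_
  refine List.ext_getElem (by simp) fun k hk hk' => ?_
  rw [List.length_map] at hk'
  have hadj := hE.adj_graphOf (S := rows es.length r (s₂.arr 1) i) (k := ⟨k, hk'⟩)
  rw [mem_rows] at hadj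
  have hle : s₂.arr 1 (i * es.length + k) ≤ 1 := hb i ⟨k, hk'⟩
  simp only [List.getElem_map, List.getElem_finRange, Fin.cast_mk]
  by_cases hc : s₂.arr 1 (i * es.length + k) = 0
  · exact hc.trans (if_neg fun h => hadj.1 h hc).symm
  · exact (show _ = 1 by omega).trans (if_pos (hadj.2 hc)).symm
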